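/- **Setting.** Let $\Sigma$ be a smooth (Hausdorff, second countable, boundaryless) three-manifold. A *Cauchy pair* $(\mathfrak e,\Theta)$ on $\Sigma$ consists of a smooth global coframe $\mathfrak e=(e_u,e_l,e_n)$ and a smooth symmetric covariant two-tensor $\Theta$. Let $(e_u^\sharp,e_l^\sharp,e_n^\sharp)$ be the dual frame, $h_{\mathfrak e}=e_u\otimes e_u+e_l\otimes e_l+e_n\otimes e_n$, and $\Theta(e_i)=\Theta(e_i^\sharp,\cdot)$. The pair is *parallel* if $$\mathrm d e_i=\Theta(e_i)\wedge e_u\quad (i=u,l,n),\qquad [\Theta(e_u)]=0\in H^1_{dR}(\Sigma),$$ the latter meaning that $\Theta(e_u)$ is exact. It is *fully complete* if the Riemannian manifold $(\Sigma,h_{\mathfrak e})$ is complete and, writing $\Theta(e_u)=-\mathrm d\mathfrak f$ and $\hat e_u=e^{\mathfrak f}e_u$, the vector field $\hat e_u^\sharp=e^{-\mathfrak f}e_u^\sharp$ (the dual of $\hat e_u$ with respect to the coframe $(\hat e_u,e_l,e_n)$) is complete. We say that $(\mathfrak e,\Theta)$ is *in normal form* with respect to global coordinates $(x,y,z)$ (a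 diffeomorphism $\Sigma\cong\mathbb R^3$), $\mathfrak u\in C^\infty(\mathbb R^3)$ and $\mathfrak F\in C^\infty(\mathbb R)$ if $$\mathfrak e=(e^{\mathfrak u}\mathrm dx,\;e_l(x),\;e_n(x)),\qquad (\mathcal L_x e_l)(e_n^\sharp)=(\mathcal L_x e_n)(e_l^\sharp),$$ where $e_l(x)$ and $e_n(x)$ are smooth $x$-dependent families of closed one-forms on the planes $\{x\}\times\mathbb R^2$ (no $\mathrm dx$-component, and closed when restricted to each plane), $\mathcal L_x$ is the Lie derivative along $\partial_x$, and, with the resulting family of flat metrics $h_x=e_l(x)\otimes e_l(x)+e_n(x)\otimes e_n(x)$, $$\Theta=\big(\mathfrak F(x)e^{-\mathfrak u}+\partial_x e^{-\mathfrak u}\big)\,e_u\otimes e_u+e_u\otimes \mathrm d\mathfrak u+\mathrm d\mathfrak u\otimes e_u-\tfrac12 e^{-\mathfrak u}\mathcal L_x h_x .$$ **Theorem.** Let $\Sigma$ be connected and simply connected, and let $(\mathfrak e,\Theta)$ be a Cauchy pair on $\Sigma$. 1. $(\mathfrak e,\Theta)$ is parallel and fully complete if and only if there exist global coordinates $(x,y,z)$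 identifying $\Sigma=\mathbb R^3$ and smooth functions $\mathfrak u\in C^\infty(\mathbb R^3)$, $\mathfrak F\in C^\infty(\mathbb R)$ for which $(\mathfrak e,\Theta)$ is in normal form, $h_{\mathfrak e}$ is complete, and the vector field $\exp\!\big(\int_0^x\mathfrak F(s)\,\mathrm ds\big)\partial_x$ on $\mathbb R$ is complete. 2. Whenever $(\mathfrak e,\Theta)$ is in normal form for some global coordinates, some $\mathfrak u\in C^\infty(\mathbb R^3)$ and an arbitrary $\mathfrak F\in C^\infty(\mathbb R)$ (no completeness assumed), it is parallel. -/

import Mathlib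

open scoped Manifold ContDiff Topology ENNReal
open Bundle

noncomputable section

namespace CauchyPair

/-- The Cartesian space `ℝ³`, with coordinates `(x, y, z) = (q 0, q 1, q 2)`. -/
abbrev R3 : Type := EuclideanSpace ℝ (Fin 3)

section Manifold

variable {M : Type*} [TopologicalSpace M] [ChartedSpace R3 M]

/-- A (not necessarily smooth) one-form on a three-manifold. -/
abbrev OneForm (M : Type*) [TopologicalSpace M] [ChartedSpace R3 M] : Type _ :=
  (p : M) → TangentSpace (𝓡 3) p →L[ℝ] ℝ

/-- A (not necessarily smooth) covariant two-tensor on a three-manifold. -/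
abbrev TwoTensor (M : Type*) [TopologicalSpace M] [ChartedSpace R3 M] : Type _ :=
  (p : M) → TangentSpace (𝓡 3) p →L[ℝ] TangentSpace (𝓡 3) p →L[ℝ] ℝ

/-- Smoothness of a one-form, as a section of the cotangent bundle. -/
def OneForm.Smooth [IsManifold (𝓡 3) ∞ M] (η : OneForm M) : Prop :=
  ContMDiff (𝓡 3) ((𝓡 3).prod 𝓘(ℝ, R3 →L[ℝ] ℝ)) ∞
    (fun p ↦ TotalSpace.mk' (R3 →L[ℝ] ℝ)
      (E := fun p : M ↦ TangentSpace (𝓡 3) p →L[ℝ] Trivial M ℝ p) p (η p))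

/-- Smoothness of a two-tensor, as a section of the bundle `T*M ⊗ T*M`. -/
def TwoTensor.Smooth [IsManifold (𝓡 3) ∞ M] (T : TwoTensor M) : Prop :=
  ContMDiff (𝓡 3) ((𝓡 3).prod 𝓘(ℝ, R3 →L[ℝ] R3 →L[ℝ] ℝ)) ∞
    (fun p ↦ TotalSpace.mk' (R3 →L[ℝ] R3 →L[ℝ] ℝ)
      (E := fun p : M ↦ TangentSpace (𝓡 3) p →L[ℝ] TangentSpace (𝓡 3) p →L[ℝ] Trivial M ℝ p)
      p (T p))

/-- The pullback of a one-form along the inverse of the preferred chart at `p`. -/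
def OneForm.inChart (η : OneForm M) (p : M) (y : R3) : R3 →L[ℝ] ℝ :=
  (η ((extChartAt (𝓡 3) p).symm y)).comp
    (mfderiv 𝓘(ℝ, R3) (𝓡 3) (extChartAt (𝓡 3) p).symm y)

/-- The exterior derivative `(dη)_p(v, w)`: the exterior derivative in `ℝ³` of the local expression
of `η` in the chart at `p`, pulled back to `p` along the chart. The normalization is
`dη(X, Y) = X(η(Y)) - Y(η(X)) - η([X, Y])`. -/
def OneForm.d (η : OneForm M) (p : M) (v w : TangentSpace (𝓡 3) p) : ℝ :=
  extDeriv
    (fun y ↦ ContinuousAlternatingMap.ofSubsingleton ℝ R3 ℝ (0 : Fin 1) (η.inChart p y))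
    (extChartAt (𝓡 3) p p)
    ![mfderiv (𝓡 3) 𝓘(ℝ, R3) (extChartAt (𝓡 3) p) p v,
      mfderiv (𝓡 3) 𝓘(ℝ, R3) (extChartAt (𝓡 3) p) p w]

/-- A smooth coframe `(e_u, e_l, e_n) = (form 0, form 1, form 2)` on a three-manifold: three smooth
one-forms which give at every point an isomorphism of the tangent space with `ℝ³`. -/
structure Coframe (M : Type*) [TopologicalSpace M] [ChartedSpace R3 M]
    [IsManifold (𝓡 3) ∞ M] where
  form : Fin 3 → OneForm M
  smooth : ∀ i, (form i).Smooth
  bijective : ∀ p, Function.Bijective (fun (v : TangentSpace (𝓡 3) p) (i : Fin 3) ↦ form i p v)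

/-- A shape operator: a smooth symmetric covariant two-tensor. -/
structure ShapeOperator (M : Type*) [TopologicalSpace M] [ChartedSpace R3 M]
    [IsManifold (𝓡 3) ∞ M] where
  tensor : TwoTensor M
  smooth : tensor.Smooth
  symm : ∀ p (v w : TangentSpace (𝓡 3) p), tensor p v w = tensor p w v

/-- A vector field is complete if through every point there is an integral curve defined on all
of `ℝ`. -/
def IsCompleteField {E H N : Type*} [NormedAddCommGroup E] [NormedSpace ℝ E] [TopologicalSpace H]
    (I : ModelWithCorners ℝ E H) [TopologicalSpace N] [ChartedSpace H N]
    (X : (p : N) → TangentSpace I p) : Prop :=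
  ∀ p, ∃ γ : ℝ → N, γ 0 = p ∧ IsMIntegralCurve (I := I) γ X

variable [IsManifold (𝓡 3) ∞ M]

namespace Coframe

/-- The dual frame `(e_u^♯, e_l^♯, e_n^♯)`, i.e. `e_i(e_j^♯) = δ_ij`. It is also the metric dual of
the coframe with respect to `h_e = e_u ⊗ e_u + e_l ⊗ e_l + e_n ⊗ e_n`. -/
def sharp (e : Coframe M) (i : Fin 3) (p : M) : TangentSpace (𝓡 3) p :=
  Function.surjInv (e.bijective p).surjective (Pi.single i 1)

theorem form_sharp (e : Coframe M) (i j : Fin 3) (p : M) :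
    e.form i p (e.sharp j p) = if i = j then 1 else 0 := by
  have h := congrFun (Function.surjInv_eq (e.bijective p).surjective
    (Pi.single j (1 : ℝ) : Fin 3 → ℝ)) i
  simpa [Pi.single_apply, sharp] using h

/-- The Riemannian metric `h_e = e_u ⊗ e_u + e_l ⊗ e_l + e_n ⊗ e_n`. -/
def metric (e : Coframe M) (p : M) (v w : TangentSpace (𝓡 3) p) : ℝ :=
  ∑ i, e.form i p v * e.form i p w

/-- The Riemannian distance of `h_e`: the infimum of the `h_e`-lengths of `C¹` paths. -/
def dist (e : Coframe M) (p q : M) : ℝ≥0∞ :=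
  letI : ∀ x : M, ENorm (TangentSpace (𝓡 3) x) :=
    fun x ↦ ⟨fun v ↦ ENNReal.ofReal (Real.sqrt (e.metric x v v))⟩
  Manifold.riemannianEDist (𝓡 3) p q

/-- Completeness of the Riemannian manifold `(M, h_e)`: Cauchy sequences for the Riemannian
distance converge. -/
def IsComplete (e : Coframe M) : Prop :=
  ∀ s : ℕ → M,
    (∀ ε : ℝ≥0∞, 0 < ε → ∃ N, ∀ m ≥ N, ∀ n ≥ N, e.dist (s m) (s n) < ε) →
    ∃ p, Filter.Tendsto (fun n ↦ e.dist (s n) p) Filter.atTop (𝓝 0)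

/-- The coframe `(exp(f) e_u, e_l, e_n)`. -/
def rescale (e : Coframe M) (f : M → ℝ) (hf : ContMDiff (𝓡 3) 𝓘(ℝ, ℝ) ∞ f) : Coframe M where
  form i p := (if i = 0 then Real.exp (f p) else 1) • e.form i p
  smooth i := by
    have hg : ContMDiff (𝓡 3) 𝓘(ℝ, ℝ) ∞ (fun p ↦ if i = 0 then Real.exp (f p) else 1) := by
      by_cases hi : i = 0
      · simp only [hi, if_true]
        exact Real.contDiff_exp.comp_contMDiff hf
      · simp only [hi, if_false]
        exact contMDiff_const
    exact hg.smul_section (e.smooth i)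
  bijective p := by
    have hpos : ∀ i : Fin 3, (if i = 0 then Real.exp (f p) else 1) ≠ 0 := by
      intro i
      split_ifs
      · exact Real.exp_ne_zero _
      · exact one_ne_zero
    constructor
    · intro v w h
      apply (e.bijective p).injective
      funext i
      have h' := congrFun h i
      simp only [smul_apply, smul_eq_mul] at h'
      exact mul_left_cancel₀ (hpos i) h'
    · intro y
      obtain ⟨v, hv⟩ := (e.bijective p).surjective
        (fun i ↦ (if i = 0 then Real.exp (f p) else 1)⁻¹ * y i)
      refine ⟨v, funext fun i ↦ ?_⟩
      have h' := congrFun hv i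
      simp only [smul_apply, smul_eq_mul] at h' ⊢
      rw [h', mul_inv_cancel_left₀ (hpos i)]

end Coframe

/-- The one-form `Θ(e_i)`, where `Θ` acts on one-forms through the metric `h_e`. -/
def thetaForm (e : Coframe M) (Θ : ShapeOperator M) (i : Fin 3) : OneForm M :=
  fun p ↦ Θ.tensor p (e.sharp i p)

/-- `f` is a smooth function with `Θ(e_u) = -df`. -/
def IsPotential (e : Coframe M) (Θ : ShapeOperator M) (f : M → ℝ) : Prop :=
  ContMDiff (𝓡 3) 𝓘(ℝ, ℝ) ∞ f ∧
    ∀ p (v : TangentSpace (𝓡 3) p), thetaForm e Θ 0 p v = -(mfderiv (𝓡 3) 𝓘(ℝ, ℝ) f p v : ℝ)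

/-- The parallel Cauchy differential system: `d e_i = Θ(e_i) ∧ e_u` for `i = u, l, n`, and
`[Θ(e_u)] = 0` in de Rham cohomology, i.e. `Θ(e_u)` is exact. -/
def IsParallel (e : Coframe M) (Θ : ShapeOperator M) : Prop :=
  (∀ (i : Fin 3) (p : M) (v w : TangentSpace (𝓡 3) p),
      (e.form i).d p v w
        = thetaForm e Θ i p v * e.form 0 p w - thetaForm e Θ i p w * e.form 0 p v) ∧
    ∃ f : M → ℝ, IsPotential e Θ f

/-- The pair is fully complete: `h_e` is complete and, with `Θ(e_u) = -df` and
`ê = (exp(f) e_u, e_l, e_n)`, the vector field `ê_u^♯` is complete. (On a connected manifold `f` is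
unique up to a constant, so that the choice of `f` is immaterial.) -/
def IsFullyComplete (e : Coframe M) (Θ : ShapeOperator M) : Prop :=
  e.IsComplete ∧
    ∃ (f : M → ℝ) (hf : IsPotential e Θ f),
      IsCompleteField (𝓡 3) ((e.rescale f hf.1).sharp 0)

end Manifold

section Coordinates

/-- The coordinate vector field `∂_x` on `ℝ³`. -/
def ex : R3 := EuclideanSpace.single 0 1

/-- The Lie derivative `(L_x η)(v)` of a one-form on `ℝ³` along the coordinate field `∂_x`: since
`∂_x` is constant, it differentiates the coefficients of `η`. -/
def lieX (η : OneForm R3) (q v : R3) : ℝ := fderiv ℝ (fun q' ↦ (η q' v : ℝ)) q ex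

/-- The Lie derivative `(L_x h_x)(v, w)` of `h_x = e_l ⊗ e_l + e_n ⊗ e_n` along `∂_x`. -/
def lieXMetric (ε : Coframe R3) (q v w : R3) : ℝ :=
  fderiv ℝ (fun q' ↦ (ε.form 1 q' v * ε.form 1 q' w + ε.form 2 q' v * ε.form 2 q' w : ℝ)) q ex

/-- `η = η(x)` is a family, parametrized by `x`, of closed one-forms on the planes `{x} × ℝ²`:
it has no `dx`-component and it restricts to a closed form on every plane `x = const`. -/
def IsClosedSliceFamily (η : OneForm R3) : Prop :=
  (∀ q, η q ex = 0) ∧ ∀ q (v w : R3), v 0 = 0 → w 0 = 0 → η.d q v w = 0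

/-- The coframe `ε` on `ℝ³` has the form `(exp(u) dx, e_l(x), e_n(x))`, with
`(L_x e_l)(e_n^♯) = (L_x e_n)(e_l^♯)`. -/
def IsNormalCoframe (ε : Coframe R3) (u : R3 → ℝ) : Prop :=
  (∀ q v : R3, ε.form 0 q v = Real.exp (u q) * v 0) ∧
    IsClosedSliceFamily (ε.form 1) ∧ IsClosedSliceFamily (ε.form 2) ∧
    ∀ q, lieX (ε.form 1) q (ε.sharp 2 q) = lieX (ε.form 2) q (ε.sharp 1 q)

/-- The two-tensor
`(F(x) exp(-u) + ∂_x exp(-u)) e_u ⊗ e_u + e_u ⊗ du + du ⊗ e_u - (1/2) exp(-u) L_x h_x` on `ℝ³`. -/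
def normalTheta (ε : Coframe R3) (u : R3 → ℝ) (F : ℝ → ℝ) (q v w : R3) : ℝ :=
  (F (q 0) * Real.exp (-u q) + fderiv ℝ (fun q' ↦ Real.exp (-u q')) q ex)
      * (ε.form 0 q v * ε.form 0 q w)
    + ε.form 0 q v * fderiv ℝ u q w + fderiv ℝ u q v * ε.form 0 q w
    - 1 / 2 * Real.exp (-u q) * lieXMetric ε q v w

/-- In the global coordinates `φ : M → ℝ³` the pair `(e, Θ)` is given by the normal coframe `ε` with
function `u` and by the two-tensor `normalTheta ε u F`. -/
structure HasNormalForm {M : Type*} [TopologicalSpace M] [ChartedSpace R3 M]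
    [IsManifold (𝓡 3) ∞ M] (e : Coframe M) (Θ : ShapeOperator M)
    (φ : M ≃ₘ^∞⟮𝓡 3, 𝓡 3⟯ R3) (ε : Coframe R3) (u : R3 → ℝ) (F : ℝ → ℝ) : Prop where
  contDiff_u : ContDiff ℝ ∞ u
  contDiff_F : ContDiff ℝ ∞ F
  coframe : ∀ (i : Fin 3) (p : M) (v : TangentSpace (𝓡 3) p),
    e.form i p v = ε.form i (φ p) (mfderiv (𝓡 3) (𝓡 3) φ p v)
  normal : IsNormalCoframe ε u
  theta : ∀ (p : M) (v w : TangentSpace (𝓡 3) p),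
    Θ.tensor p v w
      = normalTheta ε u F (φ p) (mfderiv (𝓡 3) (𝓡 3) φ p v) (mfderiv (𝓡 3) (𝓡 3) φ p w)

/-- The vector field `exp(∫₀ˣ F) ∂_x` on the real line. -/
def lineField (F : ℝ → ℝ) (x : ℝ) : TangentSpace 𝓘(ℝ, ℝ) x :=
  (Real.exp (∫ s in (0 : ℝ)..x, F s) : ℝ)

end Coordinates

end CauchyPair

end

/-!
If `Θ(e_u) = -df`, the parallel equations say that `exp(f) e_u` is closed and that `e_l`, `e_n`
restrict to closed forms on the leaves of `ker e_u`. On a simply connected manifold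
`exp(f) e_u = dx`. The fields `e_l^♯`, `e_n^♯` have unit length, so they are complete when `h_e`
is, and `ê_u^♯` is complete by assumption. The flow of `ê_u^♯` projects the manifold onto the slice
`x = 0`, on which `e_l` and `e_n` are closed; primitives of their pullbacks along this projection
are the coordinates `y` and `z`. Flowing successively along `e_n^♯`, `e_l^♯` and `ê_u^♯` gives a
right inverse of `(x, y, z)` whose image is open and closed, so `(x, y, z)` is a diffeomorphism. In
these coordinates the parallel equations determine `Θ`, with `u = -f` and `F = 0`.

Conversely, in normal form `-(u + ∫₀ˣ F)` is a potential of `Θ(e_u)`, and rescaling by it turns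
`e_u^♯` into `exp(∫₀ˣ F) ∂_x`.
-/

noncomputable section

namespace CauchyPair

/-! ### Flow of a vector field on a normed space -/

section FlowSmoothness

open Set unitInterval

section Superposition

universe v

variable {K : Type*} [TopologicalSpace K] [CompactSpace K]

set_option synthInstance.maxHeartbeats 200000 in
-- The search for the norm on `C(K, E →L[ℝ] F)` is long.
/-- Pointwise evaluation of a family of operators on a family of vectors, as a continuous bilinear
map between spaces of continuous functions. With `A = f' ∘ α` it is the derivative at `α` of the
superposition operator `β ↦ f ∘ β`. -/
def pointwiseApplyL (K : Type*) [TopologicalSpace K] [CompactSpace K] (E F : Type*)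
    [NormedAddCommGroup E] [NormedSpace ℝ E] [NormedAddCommGroup F] [NormedSpace ℝ F] :
    C(K, E →L[ℝ] F) →L[ℝ] C(K, E) →L[ℝ] C(K, F) :=
  LinearMap.mkContinuous₂
    (LinearMap.mk₂ ℝ (fun (A : C(K, E →L[ℝ] F)) (h : C(K, E)) ↦
        (⟨fun t ↦ A t (h t), A.continuous.clm_apply h.continuous⟩ : C(K, F)))
      (fun A B h ↦ by ext t; simp) (fun c A h ↦ by ext t; simp)
      (fun A h k ↦ by ext t; simp) (fun c A h ↦ by ext t; simp)) 1
    (fun A h ↦ by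
      rw [one_mul, ContinuousMap.norm_le _ (by positivity)]
      intro t
      exact (A t).le_of_opNorm_le_of_le (A.norm_coe_le_norm t) (h.norm_coe_le_norm t))

@[simp]
theorem pointwiseApplyL_apply {E F : Type*} [NormedAddCommGroup E] [NormedSpace ℝ E]
    [NormedAddCommGroup F] [NormedSpace ℝ F] (A : C(K, E →L[ℝ] F)) (h : C(K, E)) (t : K) :
    pointwiseApplyL K E F A h t = A t (h t) := rfl

theorem exists_forall_norm_comp_sub_le {X F : Type*} [PseudoMetricSpace X] [NormedAddCommGroup F]
    (g : C(X, F)) (α : C(K, X)) {c : ℝ} (hc : 0 < c) :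
    ∃ δ > 0, ∀ β : C(K, X), Dist.dist β α < δ → ∀ t, ‖g (β t) - g (α t)‖ ≤ c := by
  obtain ⟨δ, hδ, hclose⟩ := Metric.continuous_iff.mp
    (g.continuous_postcomp : Continuous fun β : C(K, X) ↦ g.comp β) α c hc
  refine ⟨δ, hδ, fun β hβ t ↦ ?_⟩
  have hnorm := hclose β hβ
  rw [dist_eq_norm] at hnorm
  exact ((g.comp β - g.comp α).norm_coe_le_norm t).trans hnorm.le

theorem hasFDerivAt_superposition {E F : Type*} [NormedAddCommGroup E] [NormedSpace ℝ E]
    [NormedAddCommGroup F] [NormedSpace ℝ F] (f : C(E, F)) (f' : C(E, E →L[ℝ] F))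
    (hf : ∀ x, HasFDerivAt f (f' x) x) (α : C(K, E)) :
    HasFDerivAt (fun β : C(K, E) ↦ f.comp β) (pointwiseApplyL K E F (f'.comp α)) α := by
  rw [hasFDerivAt_iff_isLittleO, Asymptotics.isLittleO_iff]
  intro c hc
  obtain ⟨δ, hδ, hclose⟩ := exists_forall_norm_comp_sub_le f' α hc
  filter_upwards [Metric.ball_mem_nhds α hδ] with β hβ
  rw [ContinuousMap.norm_le _ (by positivity)]
  intro t
  have hbound : ∀ x ∈ segment ℝ (α t) (β t), ‖f' x - f' (α t)‖ ≤ c := by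
    rw [segment_eq_image']
    rintro _ ⟨s, hs, rfl⟩
    refine hclose (α + s • (β - α)) ?_ t
    rw [dist_eq_norm, add_sub_cancel_left, norm_smul, Real.norm_of_nonneg hs.1]
    calc s * ‖β - α‖ ≤ 1 * ‖β - α‖ := by gcongr; exact hs.2
      _ = Dist.dist β α := by rw [one_mul, dist_eq_norm]
      _ < δ := hβ
  have hmean := (convex_segment (𝕜 := ℝ) (α t) (β t)).norm_image_sub_le_of_norm_hasFDerivWithin_le'
    (fun x _ ↦ (hf x).hasFDerivWithinAt) hbound (left_mem_segment ℝ _ _) (right_mem_segment ℝ _ _)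
  calc ‖(f.comp β - f.comp α - pointwiseApplyL K E F (f'.comp α) (β - α)) t‖
      = ‖f (β t) - f (α t) - f' (α t) (β t - α t)‖ := by simp
    _ ≤ c * ‖β t - α t‖ := hmean
    _ ≤ c * ‖β - α‖ := by
      gcongr
      exact (β - α).norm_coe_le_norm t

set_option synthInstance.maxHeartbeats 200000 in
-- The search for the norm on `C(K, E →L[ℝ] F)` is long.
theorem contDiff_superposition {E : Type v} [NormedAddCommGroup E] [NormedSpace ℝ E] (n : ℕ) :
    ∀ {F : Type v} [NormedAddCommGroup F] [NormedSpace ℝ F] (f : C(E, F)),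
      ContDiff ℝ n f → ContDiff ℝ n (fun β : C(K, E) ↦ f.comp β) := by
  induction n with
  | zero => exact fun f _ ↦ contDiff_zero.mpr f.continuous_postcomp
  | succ n ih =>
    intro F _ _ f hf
    obtain ⟨f', hf', hderiv⟩ := contDiff_succ_iff_hasFDerivAt.mp (by exact_mod_cast hf)
    let f'C : C(E, E →L[ℝ] F) := ⟨f', hf'.continuous⟩
    push_cast
    refine contDiff_succ_iff_hasFDerivAt.mpr ⟨fun α ↦ pointwiseApplyL K E F (f'C.comp α), ?_,
      hasFDerivAt_superposition f f'C hderiv⟩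
    exact (pointwiseApplyL K E F).contDiff.comp (ih f'C hf')

end Superposition

section LocalFlow

variable {E : Type*} [NormedAddCommGroup E] [NormedSpace ℝ E]

/-- The operator `β ↦ (t ↦ ∫₀ᵗ β)` on continuous functions on the unit interval. It turns the
equation of integral curves into an equation in a Banach space. The integrand is extended to `ℝ`
by constants. -/
def primitiveL (E : Type*) [NormedAddCommGroup E] [NormedSpace ℝ E] : C(I, E) →L[ℝ] C(I, E) :=
  have hcont (β : C(I, E)) : Continuous fun τ : ℝ ↦ β (projIcc 0 1 zero_le_one τ) :=
    β.continuous.comp continuous_projIcc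
  LinearMap.mkContinuous
    { toFun β := ⟨fun t ↦ ∫ τ in (0 : ℝ)..t, β (projIcc 0 1 zero_le_one τ),
        (intervalIntegral.continuous_primitive
          (fun a b ↦ (hcont β).intervalIntegrable a b) 0).comp continuous_subtype_val⟩
      map_add' β γ := by
        ext t
        exact intervalIntegral.integral_add ((hcont β).intervalIntegrable _ _)
          ((hcont γ).intervalIntegrable _ _)
      map_smul' c β := by
        ext t
        exact intervalIntegral.integral_smul _ _ } 1
    (fun β ↦ by
      rw [one_mul, ContinuousMap.norm_le _ (by positivity)]
      intro t
      have hle := intervalIntegral.norm_integral_le_of_norm_le_const (a := (0 : ℝ)) (b := t)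
        (f := fun τ ↦ β (projIcc 0 1 zero_le_one τ)) (C := ‖β‖) (fun τ _ ↦ β.norm_coe_le_norm _)
      refine hle.trans ?_
      rw [sub_zero, abs_of_nonneg t.2.1]
      exact mul_le_of_le_one_right (norm_nonneg _) t.2.2)

theorem primitiveL_restrict {g : ℝ → E} {β : C(I, E)} (hβ : ∀ τ : I, β τ = g τ) (t : I) :
    primitiveL E β t = ∫ τ in (0 : ℝ)..t, g τ := by
  refine intervalIntegral.integral_congr fun τ hτ ↦ ?_
  rw [uIcc_of_le t.2.1] at hτ
  have hτI : τ ∈ I := ⟨hτ.1, hτ.2.trans t.2.2⟩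
  simp only [projIcc_of_mem zero_le_one hτI, hβ]

/-- The defect of a curve `β` on `[0, 1]` in the integral equation
`β(t) = x + s ∫₀ᵗ f(β(τ)) dτ`, whose solutions are the integral curves of `f` from `x`, run at
speed `s`. Here `w = ((x, s), β)`. -/
def integralDefect (f : C(E, E)) (w : (E × ℝ) × C(I, E)) : C(I, E) :=
  w.2 - ContinuousLinearMap.const ℝ I w.1.1 - w.1.2 • primitiveL E (f.comp w.2)

theorem contDiff_integralDefect {n : ℕ} {f : C(E, E)} (hf : ContDiff ℝ n f) :
    ContDiff ℝ n (integralDefect f) := by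
  have hconst : ContDiff ℝ n (ContinuousLinearMap.const ℝ I : E →L[ℝ] C(I, E)) :=
    ContinuousLinearMap.contDiff _
  refine (contDiff_snd.sub (hconst.comp (contDiff_fst.comp contDiff_fst))).sub ?_
  exact (contDiff_snd.comp contDiff_fst).smul
    ((primitiveL E).contDiff.comp ((contDiff_superposition n f hf).comp contDiff_snd))

theorem isInvertible_fderiv_integralDefect {f : C(E, E)} {x : E} {c : C(I, E)}
    (hdiff : DifferentiableAt ℝ (integralDefect f) ((x, 0), c)) :
    (fderiv ℝ (integralDefect f) ((x, 0), c) ∘L .inr ℝ (E × ℝ) C(I, E)).IsInvertible := by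
  have hchain : HasFDerivAt (fun β : C(I, E) ↦ integralDefect f ((x, 0), β))
      (fderiv ℝ (integralDefect f) ((x, 0), c) ∘L .inr ℝ (E × ℝ) C(I, E)) c :=
    HasFDerivAt.comp c (f := fun β : C(I, E) ↦ ((x, (0 : ℝ)), β)) hdiff.hasFDerivAt
      (hasFDerivAt_prodMk_right _ _)
  have hid : HasFDerivAt (fun β : C(I, E) ↦ integralDefect f ((x, 0), β))
      (ContinuousLinearMap.id ℝ C(I, E)) c := by
    simp only [integralDefect, zero_smul, sub_zero]
    exact (hasFDerivAt_id c).sub_const _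
  rw [hchain.unique hid]
  exact ⟨ContinuousLinearEquiv.refl ℝ _, rfl⟩

theorem integralDefect_eq_zero [CompleteSpace E] {f : C(E, E)} {x : E} {s : ℝ} {c : ℝ → E}
    (h0 : c 0 = x) (hc : ∀ t : I, HasDerivAt c (f (c (s * t))) (s * t)) {β : C(I, E)}
    (hβ : ∀ t : I, β t = c (s * t)) : integralDefect f ((x, s), β) = 0 := by
  have hderiv (τ : I) : HasDerivAt (fun τ : ℝ ↦ c (s * τ)) (s • f (c (s * τ))) (τ : ℝ) :=
    (hc τ).scomp (τ : ℝ) (by simpa using (hasDerivAt_id (τ : ℝ)).const_mul s)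
  ext t
  have hmem {τ : ℝ} (hτ : τ ∈ uIcc (0 : ℝ) t) : τ ∈ I := by
    rw [uIcc_of_le t.2.1] at hτ
    exact ⟨hτ.1, hτ.2.trans t.2.2⟩
  have hftc : ∫ τ in (0 : ℝ)..t, s • f (c (s * τ)) = c (s * t) - c (s * 0) := by
    refine intervalIntegral.integral_eq_sub_of_hasDerivAt (f := fun τ ↦ c (s * τ))
      (fun τ hτ ↦ hderiv ⟨τ, hmem hτ⟩) (ContinuousOn.intervalIntegrable ?_)
    exact continuousOn_const.smul (f.continuous.comp_continuousOn fun τ hτ ↦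
      (hderiv ⟨τ, hmem hτ⟩).continuousAt.continuousWithinAt)
  rw [intervalIntegral.integral_smul, mul_zero, h0] at hftc
  have hprim : primitiveL E (f.comp β) t = ∫ τ in (0 : ℝ)..t, f (c (s * τ)) :=
    primitiveL_restrict (g := fun τ ↦ f (c (s * τ))) (fun τ ↦ by simp [hβ]) t
  simp [integralDefect, hprim, hftc, hβ]

theorem eventually_forall_mul_unitInterval {X : Type*} [TopologicalSpace X] {x₀ : X}
    {P : X × ℝ → Prop} (hP : ∀ᶠ z in 𝓝 (x₀, (0 : ℝ)), P z) :
    ∀ᶠ z in 𝓝 (x₀, (0 : ℝ)), ∀ t : I, P (z.1, z.2 * t) := by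
  have hscale (t : I) : ContinuousAt (fun w : (X × ℝ) × I ↦ (w.1.1, w.1.2 * (w.2 : ℝ)))
      ((x₀, 0), t) := by fun_prop
  have hnhds := isCompact_univ.eventually_forall_of_forall_eventually
    (x₀ := (x₀, (0 : ℝ))) (P := fun z (t : I) ↦ P (z.1, z.2 * t)) fun t _ ↦
      (hscale t).eventually (by simpa using hP)
  exact hnhds.mono fun z hz t ↦ hz t (mem_univ t)

theorem contDiffAt_of_hasDerivAt_flow [CompleteSpace E] {n : ℕ} (hn : n ≠ 0) {f : E → E}
    (hf : ContDiff ℝ n f) {x₀ : E} {α : E × ℝ → E}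
    (hcont : ∀ᶠ z in 𝓝 (x₀, (0 : ℝ)), ContinuousAt α z) (h0 : ∀ᶠ x in 𝓝 x₀, α (x, 0) = x)
    (hα : ∀ᶠ z in 𝓝 (x₀, (0 : ℝ)), HasDerivAt (fun t ↦ α (z.1, t)) (f (α z)) z.2) :
    ContDiffAt ℝ n α (x₀, 0) := by
  have hn0 : (n : WithTop ℕ∞) ≠ 0 := by exact_mod_cast hn
  let fC : C(E, E) := ⟨f, hf.continuous⟩
  let w₀ : (E × ℝ) × C(I, E) := ((x₀, 0), ContinuousLinearMap.const ℝ I x₀)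
  have hdefect : ContDiffAt ℝ n (integralDefect fC) w₀ := (contDiff_integralDefect hf).contDiffAt
  have hw₀ : integralDefect fC w₀ = 0 := by simp [integralDefect, w₀]
  have hinv := isInvertible_fderiv_integralDefect (hdefect.differentiableAt hn0)
  have himplicit := hdefect.contDiffAt_implicitFunction hn0 hinv
  have hunique := hdefect.eventually_apply_eq_iff_implicitFunction hn0 hinv
  set A := hdefect.implicitFunction hn0 hinv
  obtain ⟨δ, hδ, hball⟩ := Metric.eventually_nhds_iff_ball.mp hunique
  have hclose : ∀ᶠ z in 𝓝 (x₀, (0 : ℝ)), Dist.dist (α z) x₀ < δ / 2 := by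
    have hlim := hcont.self_of_nhds.tendsto
    rw [h0.self_of_nhds] at hlim
    exact hlim.eventually (Metric.ball_mem_nhds x₀ (half_pos hδ))
  have hkey : α =ᶠ[𝓝 (x₀, (0 : ℝ))] fun z ↦ A z 1 := by
    filter_upwards [Metric.ball_mem_nhds (x₀, (0 : ℝ)) hδ, eventually_forall_mul_unitInterval hcont,
      eventually_forall_mul_unitInterval hα, eventually_forall_mul_unitInterval hclose,
      continuousAt_fst.eventually h0] with z hz hzcont hzα hzclose hz0
    let c : C(I, E) := ⟨fun t ↦ α (z.1, z.2 * t), continuous_iff_continuousAt.mpr fun t ↦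
      ContinuousAt.comp (f := fun t : I ↦ (z.1, z.2 * (t : ℝ))) (hzcont t) (by fun_prop)⟩
    have hcball : Dist.dist c (ContinuousLinearMap.const ℝ I x₀) < δ :=
      ((ContinuousMap.dist_le (half_pos hδ).le).mpr fun t ↦ (hzclose t).le).trans_lt
        (half_lt_self hδ)
    have hzero : integralDefect fC (z, c) = integralDefect fC w₀ := by
      rw [hw₀]
      exact integralDefect_eq_zero (c := fun t ↦ α (z.1, t)) hz0 hzα fun _ ↦ rfl
    have hAc : A z = c := (hball (z, c) (by
      rw [← ball_prod_same]; exact ⟨hz, hcball⟩)).mp hzero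
    simp [hAc, c]
  have hA1 : ContDiffAt ℝ n (fun z ↦ A z 1) (x₀, (0 : ℝ)) :=
    (ContinuousMap.evalCLM ℝ (1 : I) : C(I, E) →L[ℝ] E).contDiff.contDiffAt.comp _ himplicit
  exact hA1.congr_of_eventuallyEq hkey

theorem exists_contDiff_eventuallyEq [HasContDiffBump E] {F : Type*} [NormedAddCommGroup F]
    [NormedSpace ℝ F] {n : ℕ} {f : E → F} {x₀ : E} (hf : ContDiffAt ℝ n f x₀) :
    ∃ g : E → F, ContDiff ℝ n g ∧ g =ᶠ[𝓝 x₀] f := by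
  obtain ⟨R, hR, hball⟩ := Metric.eventually_nhds_iff_ball.mp (hf.eventually (by simp))
  let χ : ContDiffBump x₀ := ⟨R / 4, R / 2, by positivity, by linarith⟩
  refine ⟨fun x ↦ χ x • f x, contDiff_iff_contDiffAt.mpr fun x ↦ ?_, ?_⟩
  · by_cases hx : x ∈ Metric.ball x₀ R
    · exact χ.contDiff.contDiffAt.smul (hball x hx)
    · have hsupp : x ∉ tsupport χ := fun h ↦ hx <|
        Metric.closedBall_subset_ball (half_lt_self hR) (χ.tsupport_eq ▸ h)
      refine (contDiffAt_const (c := 0)).congr_of_eventuallyEq ?_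
      filter_upwards [notMem_tsupport_iff_eventuallyEq.mp hsupp] with y hy
      simp [hy]
  · filter_upwards [χ.eventuallyEq_one] with x hx
    simp [hx]

theorem exists_contDiffAt_flow [CompleteSpace E] [HasContDiffBump E] {n : ℕ} (hn : n ≠ 0)
    {f : E → E} {x₀ : E} (hf : ContDiffAt ℝ n f x₀) :
    ∃ α : E × ℝ → E, (∀ᶠ z in 𝓝 (x₀, (0 : ℝ)), ContDiffAt ℝ n α z) ∧
      (∀ᶠ x in 𝓝 x₀, α (x, 0) = x) ∧
      ∀ᶠ z in 𝓝 (x₀, (0 : ℝ)), HasDerivAt (fun t ↦ α (z.1, t)) (f (α z)) z.2 := by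
  obtain ⟨g, hg, hgf⟩ := exists_contDiff_eventuallyEq hf
  have hf1 : ContDiffAt ℝ 1 f x₀ := hf.of_le (by exact_mod_cast Nat.one_le_iff_ne_zero.mpr hn)
  obtain ⟨ε, hε, a, r, L, K, hr, hpl⟩ := IsPicardLindelof.of_contDiffAt_one hf1
  obtain ⟨α, hα, hαc⟩ := (hpl 0).exists_forall_mem_closedBall_eq_hasDerivWithinAt_continuousOn
  simp only [zero_sub, zero_add] at hα hαc
  have hball : Metric.closedBall x₀ r ∈ 𝓝 x₀ := Metric.closedBall_mem_nhds _ hr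
  have hα0 : ∀ᶠ x in 𝓝 x₀, α (x, 0) = x := by
    filter_upwards [hball] with x hx using (hα x hx).1
  have hαderiv : ∀ᶠ z in 𝓝 (x₀, (0 : ℝ)), HasDerivAt (fun t ↦ α (z.1, t)) (f (α z)) z.2 := by
    filter_upwards [prod_mem_nhds hball (Ioo_mem_nhds (neg_lt_zero.mpr hε) hε)] with z hz
    exact ((hα z.1 hz.1).2 z.2 (Ioo_subset_Icc_self hz.2)).hasDerivAt
      (Icc_mem_nhds hz.2.1 hz.2.2)
  have hαcont : ∀ᶠ z in 𝓝 (x₀, (0 : ℝ)), ContinuousAt α z := by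
    have hmem : Metric.closedBall x₀ r ×ˢ Icc (-ε) ε ∈ 𝓝 (x₀, (0 : ℝ)) :=
      prod_mem_nhds hball (Icc_mem_nhds (neg_lt_zero.mpr hε) hε)
    filter_upwards [eventually_mem_nhds_iff.mpr hmem] with z hz using hαc.continuousAt hz
  have hgα : ∀ᶠ z in 𝓝 (x₀, (0 : ℝ)), HasDerivAt (fun t ↦ α (z.1, t)) (g (α z)) z.2 := by
    have hlim := hαcont.self_of_nhds.tendsto
    rw [hα0.self_of_nhds] at hlim
    filter_upwards [hαderiv, hlim.eventually hgf] with z hz hzg using hzg ▸ hz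
  exact ⟨α, (contDiffAt_of_hasDerivAt_flow hn hg hαcont hα0 hgα).eventually (by simp), hα0, hαderiv⟩

end LocalFlow

end FlowSmoothness

section ManifoldFlows

open Filter Set

theorem hasMFDerivAt_comp_curve {E E' H H' N N' : Type*}
    [NormedAddCommGroup E] [NormedSpace ℝ E] [TopologicalSpace H] {I : ModelWithCorners ℝ E H}
    [TopologicalSpace N] [ChartedSpace H N]
    [NormedAddCommGroup E'] [NormedSpace ℝ E'] [TopologicalSpace H'] {J : ModelWithCorners ℝ E' H'}
    [TopologicalSpace N'] [ChartedSpace H' N']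
    {g : N → N'} {γ : ℝ → N} {t : ℝ} {v : TangentSpace I (γ t)}
    {L : TangentSpace I (γ t) →L[ℝ] TangentSpace J (g (γ t))} (hg : HasMFDerivAt I J g (γ t) L)
    (hγ : HasMFDerivAt 𝓘(ℝ, ℝ) I γ t ((1 : ℝ →L[ℝ] ℝ).smulRight v)) :
    HasMFDerivAt 𝓘(ℝ, ℝ) J (fun s ↦ g (γ s)) t ((1 : ℝ →L[ℝ] ℝ).smulRight (L v)) :=
  (HasMFDerivAt.comp t hg hγ).congr_mfderiv <| ContinuousLinearMap.ext fun _ ↦ map_smul L _ v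

variable {E : Type*} [NormedAddCommGroup E] [NormedSpace ℝ E]
  {M : Type*} [TopologicalSpace M] [ChartedSpace E M]
  {X : (p : M) → TangentSpace 𝓘(ℝ, E) p}

/-- The expression of a vector field in the preferred chart at `p₀`, a vector field on the model
space that is only meaningful on the target of the chart. -/
def chartField (X : (p : M) → TangentSpace 𝓘(ℝ, E) p) (p₀ : M) (y : E) : E :=
  mfderiv 𝓘(ℝ, E) 𝓘(ℝ, E) (extChartAt 𝓘(ℝ, E) p₀) ((extChartAt 𝓘(ℝ, E) p₀).symm y)
    (X ((extChartAt 𝓘(ℝ, E) p₀).symm y))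

theorem contDiffAt_chartField [IsManifold 𝓘(ℝ, E) 1 M] {n : WithTop ℕ∞}
    [IsManifold 𝓘(ℝ, E) n M] {p₀ : M}
    (hX : ContMDiffAt 𝓘(ℝ, E) 𝓘(ℝ, E).tangent n
      (fun p ↦ (⟨p, X p⟩ : TangentBundle 𝓘(ℝ, E) M)) p₀) :
    ContDiffAt ℝ n (chartField X p₀) (extChartAt 𝓘(ℝ, E) p₀ p₀) := by
  have hcoord : ContMDiffAt 𝓘(ℝ, E) 𝓘(ℝ, E) n
      (fun p ↦ (mfderiv 𝓘(ℝ, E) 𝓘(ℝ, E) (extChartAt 𝓘(ℝ, E) p₀) p (X p) : E)) p₀ := by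
    refine ((contMDiffAt_section p₀).mp hX).congr_of_eventuallyEq ?_
    filter_upwards [(chartAt E p₀).open_source.mem_nhds (mem_chart_source E p₀)] with p hp
    refine (DFunLike.congr_fun (TangentBundle.continuousLinearMapAt_trivializationAt
      (I := 𝓘(ℝ, E)) hp) (X p)).symm.trans ?_
    rw [Trivialization.continuousLinearMapAt_apply, Trivialization.linearMapAt_apply, if_pos]
    simpa using hp
  have hsymm : ContMDiffAt 𝓘(ℝ, E) 𝓘(ℝ, E) n (extChartAt 𝓘(ℝ, E) p₀).symm
      (extChartAt 𝓘(ℝ, E) p₀ p₀) :=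
    (contMDiffOn_extChartAt_symm p₀).contMDiffAt (extChartAt_target_mem_nhds p₀)
  exact contMDiffAt_iff_contDiffAt.mp
    (ContMDiffAt.comp (extChartAt 𝓘(ℝ, E) p₀ p₀) (by simpa using hcoord) hsymm)

theorem hasMFDerivAt_extChartAt_symm_comp [IsManifold 𝓘(ℝ, E) 1 M] (p₀ : M) {c : ℝ → E} {t : ℝ}
    (ht : c t ∈ (extChartAt 𝓘(ℝ, E) p₀).target) (hc : HasDerivAt c (chartField X p₀ (c t)) t) :
    HasMFDerivAt 𝓘(ℝ, ℝ) 𝓘(ℝ, E) (fun s ↦ (extChartAt 𝓘(ℝ, E) p₀).symm (c s)) t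
      ((1 : ℝ →L[ℝ] ℝ).smulRight (X ((extChartAt 𝓘(ℝ, E) p₀).symm (c t)))) := by
  have hdiff : MDifferentiableAt 𝓘(ℝ, E) 𝓘(ℝ, E) (extChartAt 𝓘(ℝ, E) p₀).symm (c t) := by
    have := mdifferentiableWithinAt_extChartAt_symm (I := 𝓘(ℝ, E)) ht
    rwa [modelWithCornersSelf_coe, range_id, mdifferentiableWithinAt_univ] at this
  have hinv := mfderivWithin_extChartAt_symm_comp_mfderiv_extChartAt (I := 𝓘(ℝ, E)) ht
  rw [modelWithCornersSelf_coe, range_id, mfderivWithin_univ] at hinv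
  have hc' : HasFDerivAt c ((1 : ℝ →L[ℝ] ℝ).smulRight (chartField X p₀ (c t))) t :=
    hasDerivAt_iff_hasFDerivAt.mp hc
  exact (hasMFDerivAt_comp_curve hdiff.hasMFDerivAt hc'.hasMFDerivAt).congr_mfderiv <|
    congrArg ((1 : ℝ →L[ℝ] ℝ).smulRight) (DFunLike.congr_fun hinv _)

theorem exists_contMDiffAt_flow [CompleteSpace E] [HasContDiffBump E] [IsManifold 𝓘(ℝ, E) 1 M]
    {n : ℕ} (hn : n ≠ 0) [IsManifold 𝓘(ℝ, E) n M] {p₀ : M}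
    (hX : ContMDiffAt 𝓘(ℝ, E) 𝓘(ℝ, E).tangent n
      (fun p ↦ (⟨p, X p⟩ : TangentBundle 𝓘(ℝ, E) M)) p₀) :
    ∃ β : M × ℝ → M,
      (∀ᶠ z in 𝓝 (p₀, (0 : ℝ)), ContMDiffAt (𝓘(ℝ, E).prod 𝓘(ℝ, ℝ)) 𝓘(ℝ, E) n β z) ∧
      (∀ᶠ p in 𝓝 p₀, β (p, 0) = p) ∧
      ∀ᶠ z in 𝓝 (p₀, (0 : ℝ)), HasMFDerivAt 𝓘(ℝ, ℝ) 𝓘(ℝ, E) (fun t ↦ β (z.1, t)) z.2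
        ((1 : ℝ →L[ℝ] ℝ).smulRight (X (β z))) := by
  obtain ⟨α, hα, hα0, hαderiv⟩ := exists_contDiffAt_flow hn (contDiffAt_chartField hX)
  set ψ := extChartAt 𝓘(ℝ, E) p₀ with hψ
  have hψcont : ContinuousAt ψ p₀ := continuousAt_extChartAt p₀
  have hlift : Tendsto (fun z : M × ℝ ↦ (ψ z.1, z.2)) (𝓝 (p₀, 0)) (𝓝 (ψ p₀, 0)) :=
    ((hψcont.comp continuousAt_fst).prodMk continuousAt_snd :
      ContinuousAt (fun z : M × ℝ ↦ (ψ z.1, z.2)) (p₀, 0))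
  have htarget : ∀ᶠ z in 𝓝 (ψ p₀, (0 : ℝ)), α z ∈ ψ.target := by
    have hlim := hα.self_of_nhds.continuousAt.tendsto
    rw [hα0.self_of_nhds] at hlim
    exact hlim (extChartAt_target_mem_nhds p₀)
  have hsource : ∀ᶠ p in 𝓝 p₀, p ∈ ψ.source := extChartAt_source_mem_nhds p₀
  refine ⟨fun z ↦ ψ.symm (α (ψ z.1, z.2)), ?_, ?_, ?_⟩
  · filter_upwards [hlift.eventually hα, hlift.eventually htarget,
      (continuousAt_fst (p := (p₀, (0 : ℝ)))).eventually hsource] with z hz hztar hzsrc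
    have hψz : ContMDiffAt 𝓘(ℝ, E) 𝓘(ℝ, E) n ψ z.1 :=
      contMDiffAt_extChartAt' (by simpa [hψ] using hzsrc)
    have hliftz : ContMDiffAt (𝓘(ℝ, E).prod 𝓘(ℝ, ℝ)) 𝓘(ℝ, E × ℝ) n
        (fun z : M × ℝ ↦ (ψ z.1, z.2)) z :=
      (hψz.comp z contMDiffAt_fst).prodMk_space contMDiffAt_snd
    have hsymm : ContMDiffAt 𝓘(ℝ, E) 𝓘(ℝ, E) n ψ.symm (α (ψ z.1, z.2)) :=
      (contMDiffOn_extChartAt_symm p₀).contMDiffAt ((isOpen_extChartAt_target p₀).mem_nhds hztar)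
    exact hsymm.comp z (hz.contMDiffAt.comp z hliftz)
  · filter_upwards [hψcont.eventually hα0, hsource] with p hp hpsrc
    rw [hp, ψ.left_inv hpsrc]
  · filter_upwards [hlift.eventually hαderiv, hlift.eventually htarget] with z hz hztar
      using hasMFDerivAt_extChartAt_symm_comp p₀ hztar hz

theorem exists_eventually_isMIntegralCurveOn [CompleteSpace E] [HasContDiffBump E]
    [IsManifold 𝓘(ℝ, E) 1 M] {p₀ : M}
    (hX : ContMDiffAt 𝓘(ℝ, E) 𝓘(ℝ, E).tangent 1
      (fun p ↦ (⟨p, X p⟩ : TangentBundle 𝓘(ℝ, E) M)) p₀) :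
    ∃ ε > 0, ∀ᶠ p in 𝓝 p₀, ∃ γ : ℝ → M, γ 0 = p ∧ IsMIntegralCurveOn γ X (Ioo (-ε) ε) := by
  have : IsManifold 𝓘(ℝ, E) ((1 : ℕ) : WithTop ℕ∞) M := by simpa
  obtain ⟨β, -, hβ0, hβ⟩ := exists_contMDiffAt_flow one_ne_zero (by exact_mod_cast hX)
  obtain ⟨U, hU, V, hV, hUV⟩ := mem_nhds_prod_iff.mp hβ
  obtain ⟨ε, hε, hball⟩ := Metric.mem_nhds_iff.mp hV
  rw [Real.ball_eq_Ioo, zero_sub, zero_add] at hball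
  refine ⟨ε, hε, ?_⟩
  filter_upwards [hU, hβ0] with p hpU hp0
  exact ⟨fun t ↦ β (p, t), hp0, fun t ht ↦
    (hUV (mk_mem_prod hpU (hball ht)) : HasMFDerivAt _ _ _ _ _).hasMFDerivWithinAt⟩

variable {φ : M → ℝ → M}

theorem eventually_contMDiffAt_integralFlow_of_abs_sub_lt {n : ℕ} {p : M} {s t ε : ℝ}
    (hadd : ∀ p s t, φ (φ p s) t = φ p (t + s))
    (hs : ∀ᶠ z in 𝓝 (p, s),
      ContMDiffAt (𝓘(ℝ, E).prod 𝓘(ℝ, ℝ)) 𝓘(ℝ, E) n (fun z : M × ℝ ↦ φ z.1 z.2) z)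
    (hε : ∀ᶠ q in 𝓝 (φ p s), ∀ r ∈ Ioo (-ε) ε,
      ContMDiffAt (𝓘(ℝ, E).prod 𝓘(ℝ, ℝ)) 𝓘(ℝ, E) n (fun z : M × ℝ ↦ φ z.1 z.2) (q, r))
    (hst : |t - s| < ε) :
    ∀ᶠ z in 𝓝 (p, t),
      ContMDiffAt (𝓘(ℝ, E).prod 𝓘(ℝ, ℝ)) 𝓘(ℝ, E) n (fun z : M × ℝ ↦ φ z.1 z.2) z := by
  have htime : ∀ᶠ q in 𝓝 p, ContMDiffAt 𝓘(ℝ, E) 𝓘(ℝ, E) n (fun q ↦ φ q s) q := by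
    have hcont : ContinuousAt (fun q : M ↦ (q, s)) p := by fun_prop
    filter_upwards [hcont.eventually hs] with q hq
      using hq.comp q (contMDiffAt_id.prodMk contMDiffAt_const)
  have hclose : ∀ᶠ r in 𝓝 t, r - s ∈ Ioo (-ε) ε :=
    (continuous_id.sub continuous_const).continuousAt
      (Ioo_mem_nhds (abs_lt.mp hst).1 (abs_lt.mp hst).2)
  have hfactor : (fun z : M × ℝ ↦ φ z.1 z.2)
      = (fun z : M × ℝ ↦ φ z.1 z.2) ∘ fun z ↦ (φ z.1 s, z.2 - s) := by
    funext z
    simp [hadd]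
  filter_upwards [continuousAt_snd.eventually hclose, continuousAt_fst.eventually htime,
    continuousAt_fst.eventually (htime.self_of_nhds.continuousAt.eventually hε)] with z hz hzs hzε
  rw [hfactor]
  exact ContMDiffAt.comp z (hzε _ hz) ((hzs.comp z contMDiffAt_fst).prodMk
    ((contDiff_id.sub contDiff_const).contMDiff.contMDiffAt.comp z contMDiffAt_snd))

variable [T2Space M]

theorem integralFlow_add [IsManifold 𝓘(ℝ, E) 1 M]
    (hX : ContMDiff 𝓘(ℝ, E) 𝓘(ℝ, E).tangent 1
      (fun p ↦ (⟨p, X p⟩ : TangentBundle 𝓘(ℝ, E) M)))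
    (h0 : ∀ p, φ p 0 = p) (hφ : ∀ p, IsMIntegralCurve (φ p) X) (p : M) (s t : ℝ) :
    φ (φ p s) t = φ p (t + s) :=
  congrFun (isMIntegralCurve_Ioo_eq_of_contMDiff_boundaryless (t₀ := 0) hX (hφ (φ p s))
    ((hφ p).comp_add s) (by simp [h0])) t

variable [CompleteSpace E] [HasContDiffBump E] [IsManifold 𝓘(ℝ, E) ∞ M]

theorem exists_eventually_contMDiffAt_integralFlow {n : ℕ} (hn : n ≠ 0)
    (hX : ContMDiff 𝓘(ℝ, E) 𝓘(ℝ, E).tangent n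
      (fun p ↦ (⟨p, X p⟩ : TangentBundle 𝓘(ℝ, E) M)))
    (h0 : ∀ p, φ p 0 = p) (hφ : ∀ p, IsMIntegralCurve (φ p) X) (p₀ : M) :
    ∃ ε > 0, ∀ᶠ p in 𝓝 p₀, ∀ t ∈ Ioo (-ε) ε,
      ContMDiffAt (𝓘(ℝ, E).prod 𝓘(ℝ, ℝ)) 𝓘(ℝ, E) n (fun z : M × ℝ ↦ φ z.1 z.2) (p, t) := by
  obtain ⟨β, hβ, hβ0, hβderiv⟩ := exists_contMDiffAt_flow hn (hX p₀)
  obtain ⟨U, hU, V, hV, hUV⟩ := mem_nhds_prod_iff.mp (hβ.and hβderiv)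
  obtain ⟨ε, hε, hball⟩ := Metric.mem_nhds_iff.mp hV
  rw [Real.ball_eq_Ioo, zero_sub, zero_add] at hball
  have hmem : ∀ {p t}, p ∈ U → t ∈ Ioo (-ε) ε → (p, t) ∈ U ×ˢ V := fun hp ht ↦ ⟨hp, hball ht⟩
  have heq : ∀ p ∈ U, β (p, 0) = p → ∀ t ∈ Ioo (-ε) ε, φ p t = β (p, t) := fun p hp hp0 t ht ↦
    isMIntegralCurveOn_Ioo_eqOn_of_contMDiff_boundaryless (t₀ := 0) ⟨neg_lt_zero.mpr hε, hε⟩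
      (hX.of_le (by exact_mod_cast Nat.one_le_iff_ne_zero.mpr hn))
      ((hφ p).isMIntegralCurveOn _) (γ' := fun t ↦ β (p, t))
      (fun s hs ↦ (hUV (hmem hp hs)).2.hasMFDerivWithinAt) (by rw [h0, hp0]) ht
  refine ⟨ε, hε, ?_⟩
  filter_upwards [eventually_mem_nhds_iff.mpr (inter_mem hU hβ0)] with p hp t ht
  refine (hUV (hmem (mem_of_mem_nhds hp).1 ht)).1.congr_of_eventuallyEq ?_
  filter_upwards [prod_mem_nhds hp (isOpen_Ioo.mem_nhds ht)] with z hz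
    using heq z.1 hz.1.1 hz.1.2 z.2 hz.2

theorem contMDiff_integralFlow
    (hX : ContMDiff 𝓘(ℝ, E) 𝓘(ℝ, E).tangent ∞ (fun p ↦ (⟨p, X p⟩ : TangentBundle 𝓘(ℝ, E) M)))
    (h0 : ∀ p, φ p 0 = p) (hφ : ∀ p, IsMIntegralCurve (φ p) X) :
    ContMDiff (𝓘(ℝ, E).prod 𝓘(ℝ, ℝ)) 𝓘(ℝ, E) ∞ (fun z : M × ℝ ↦ φ z.1 z.2) := by
  suffices H : ∀ n : ℕ, n ≠ 0 → ContMDiff (𝓘(ℝ, E).prod 𝓘(ℝ, ℝ)) 𝓘(ℝ, E) n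
      (fun z : M × ℝ ↦ φ z.1 z.2) from
    contMDiff_infty.mpr fun n ↦ (H (n + 1) n.succ_ne_zero).of_le (by exact_mod_cast n.le_succ)
  rintro n hn ⟨p, t⟩
  have hadd := integralFlow_add (hX.of_le (by exact_mod_cast le_top)) h0 hφ
  have hloc := exists_eventually_contMDiffAt_integralFlow hn
    (hX.of_le (by exact_mod_cast le_top)) h0 hφ
  let S : Set ℝ := {t | ∀ᶠ z in 𝓝 (p, t),
    ContMDiffAt (𝓘(ℝ, E).prod 𝓘(ℝ, ℝ)) 𝓘(ℝ, E) n (fun z : M × ℝ ↦ φ z.1 z.2) z}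
  have hzero : (0 : ℝ) ∈ S := by
    obtain ⟨ε, hε, hp⟩ := hloc p
    filter_upwards [hp.prod_inl_nhds 0,
      continuousAt_snd (Ioo_mem_nhds (neg_lt_zero.mpr hε) hε)] with z hz hzt using hz z.2 hzt
  have hopen : IsOpen S := isOpen_iff_mem_nhds.mpr fun t ht ↦
    (Continuous.prodMk_right p).continuousAt.eventually (eventually_eventually_nhds.mpr ht)
  have hclosed : IsClosed S := isClosed_of_closure_subset fun t ht ↦ by
    obtain ⟨ε, hε, hp⟩ := hloc (φ p t)
    have hclose : ∀ᶠ s in 𝓝 t, |t - s| < ε := by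
      filter_upwards [Metric.ball_mem_nhds t hε] with s hs using by rwa [abs_sub_comm]
    obtain ⟨s, hs, hst, hsε⟩ := ((mem_closure_iff_frequently.mp ht).and_eventually
      (hclose.and ((hφ p).continuous.continuousAt.eventually
        (eventually_eventually_nhds.mpr hp)))).exists
    exact eventually_contMDiffAt_integralFlow_of_abs_sub_lt hadd hs hsε hst
  have ht : t ∈ S := IsClopen.eq_univ ⟨hclosed, hopen⟩ ⟨0, hzero⟩ ▸ mem_univ t
  exact Eventually.self_of_nhds ht

end ManifoldFlows

/-! ### Pullback and exactness of one-forms -/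

section PullbackOfOneForms

open Set Filter

section Curl

variable {E F : Type*} [NormedAddCommGroup E] [NormedSpace ℝ E] [NormedAddCommGroup F]
  [NormedSpace ℝ F]

/-- The exterior derivative `dθ_y(v, w)` of a one-form on a vector space, as an antisymmetrized
derivative. -/
def curl (θ : E → E →L[ℝ] ℝ) (y v w : E) : ℝ := fderiv ℝ θ y v w - fderiv ℝ θ y w v

theorem differentiableAt_ofSubsingleton {θ : E → E →L[ℝ] ℝ} {y : E}
    (hθ : DifferentiableAt ℝ θ y) : DifferentiableAt ℝ
      (fun y ↦ ContinuousAlternatingMap.ofSubsingleton ℝ E ℝ (0 : Fin 1) (θ y)) y :=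
  (ContinuousAlternatingMap.ofSubsingletonLIE (𝕜 := ℝ) (E := E) (F := ℝ)
    (0 : Fin 1)).toContinuousLinearEquiv.differentiableAt.comp y hθ

theorem extDeriv_ofSubsingleton {θ : E → E →L[ℝ] ℝ} {y : E} (hθ : DifferentiableAt ℝ θ y)
    (v w : E) :
    extDeriv (fun y ↦ ContinuousAlternatingMap.ofSubsingleton ℝ E ℝ (0 : Fin 1) (θ y)) y ![v, w]
      = curl θ y v w := by
  have hflip (v : E) : fderiv ℝ (fun y ↦ θ y v) y = (fderiv ℝ θ y).flip v := by
    ext w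
    simp [fderiv_clm_apply hθ (differentiableAt_const v)]
  simp [extDeriv_apply (differentiableAt_ofSubsingleton hθ), Fin.sum_univ_two, curl,
    Fin.removeNth, hflip, sub_eq_add_neg]

theorem curl_comp_fderiv {θ : F → F →L[ℝ] ℝ} {τ : E → F} {y : E}
    (hθ : DifferentiableAt ℝ θ (τ y)) (hτ : ContDiffAt ℝ 2 τ y) (v w : E) :
    curl (fun y ↦ (θ (τ y)).comp (fderiv ℝ τ y)) y v w
      = curl θ (τ y) (fderiv ℝ τ y v) (fderiv ℝ τ y w) := by
  have hpull := DFunLike.congr_fun (extDeriv_pullback (differentiableAt_ofSubsingleton hθ) hτ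
    (by rw [minSmoothness_of_isRCLikeNormedField])) ![v, w]
  have hcomp : DifferentiableAt ℝ (fun y ↦ (θ (τ y)).comp (fderiv ℝ τ y)) y :=
    (hθ.comp y (hτ.differentiableAt (by simp))).clm_comp
      ((hτ.fderiv_right (m := 1) (by norm_cast)).differentiableAt (by simp))
  have hvec : ⇑(fderiv ℝ τ y) ∘ ![v, w] = ![fderiv ℝ τ y v, fderiv ℝ τ y w] := by
    funext i
    fin_cases i <;> rfl
  rw [ContinuousAlternatingMap.compContinuousLinearMap_apply, hvec] at hpull
  rw [← extDeriv_ofSubsingleton hθ, ← extDeriv_ofSubsingleton hcomp]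
  exact hpull

theorem curl_smul {G : E → ℝ} {θ : E → E →L[ℝ] ℝ} {y : E} (hG : DifferentiableAt ℝ G y)
    (hθ : DifferentiableAt ℝ θ y) (v w : E) :
    curl (fun y ↦ G y • θ y) y v w
      = G y * curl θ y v w + (fderiv ℝ G y v * θ y w - fderiv ℝ G y w * θ y v) := by
  have hderiv : HasFDerivAt (fun y ↦ G y • θ y) _ y := hG.hasFDerivAt.smul hθ.hasFDerivAt
  rw [curl, hderiv.fderiv, curl]
  simp only [add_apply, smul_apply, smul_eq_mul, ContinuousLinearMap.smulRight_apply]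
  ring

end Curl

section OneForm

variable {M : Type*} [TopologicalSpace M] [ChartedSpace R3 M]

/-- The differential of a function, as a one-form. -/
def differential (g : M → ℝ) : OneForm M :=
  fun p ↦ mfderiv (𝓡 3) 𝓘(ℝ, ℝ) g p

/-- The pullback of a one-form along a map. -/
def OneForm.pullback {N : Type*} [TopologicalSpace N] [ChartedSpace R3 N] (η : OneForm M)
    (f : N → M) : OneForm N :=
  fun p ↦ (η (f p)).comp (mfderiv (𝓡 3) (𝓡 3) f p)

/-- A one-form on `ℝ³` as a function with values in a fixed space, the dual of `ℝ³`, so that it can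
be differentiated. -/
def OneForm.coeff (η : OneForm R3) (q : R3) : R3 →L[ℝ] ℝ := η q

theorem OneForm.pullback_id (η : OneForm M) : η.pullback id = η := by
  funext p
  rw [OneForm.pullback, mfderiv_id]
  rfl

variable [IsManifold (𝓡 3) ∞ M]

theorem OneForm.inChart_mfderiv_extChartAt (η : OneForm M) {p q : M}
    (hq : q ∈ (extChartAt (𝓡 3) p).source) (v : TangentSpace (𝓡 3) q) :
    η.inChart p (extChartAt (𝓡 3) p q) (mfderiv (𝓡 3) (𝓡 3) (extChartAt (𝓡 3) p) q v)
      = η q v := by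
  have hinv := mfderivWithin_extChartAt_symm_comp_mfderiv_extChartAt' hq
  rw [modelWithCornersSelf_coe, range_id, mfderivWithin_univ] at hinv
  have hη : (η ((extChartAt (𝓡 3) p).symm (extChartAt (𝓡 3) p q)) : R3 →L[ℝ] ℝ) = η q := by
    rw [(extChartAt (𝓡 3) p).left_inv hq]
  change (η ((extChartAt (𝓡 3) p).symm (extChartAt (𝓡 3) p q)) : R3 →L[ℝ] ℝ)
    (mfderiv (𝓡 3) (𝓡 3) (extChartAt (𝓡 3) p).symm (extChartAt (𝓡 3) p q)
      (mfderiv (𝓡 3) (𝓡 3) (extChartAt (𝓡 3) p) q v)) = η q v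
  rw [hη]
  exact congrArg (η q) (DFunLike.congr_fun hinv v)

theorem OneForm.Smooth.contDiffOn_pullback {η : OneForm M} (hη : η.Smooth) {ψ : R3 → M}
    {O : Set R3} (hO : IsOpen O) (hψ : ContMDiffOn (𝓡 3) (𝓡 3) ∞ ψ O) :
    ContDiffOn ℝ ∞ (η.pullback ψ).coeff O := by
  refine contDiffOn_clm_apply.mpr fun v ↦ ?_
  have hconst : ContMDiff (𝓡 3) (𝓡 3).tangent ∞
      (fun y : R3 ↦ (⟨y, v⟩ : TangentBundle (𝓡 3) R3)) :=
    contMDiff_vectorSpace_iff_contDiff.mpr contDiff_const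
  have htangent : ContMDiffOn (𝓡 3) (𝓡 3).tangent ∞
      (fun y ↦ (⟨ψ y, mfderivWithin (𝓡 3) (𝓡 3) ψ O y v⟩ : TangentBundle (𝓡 3) M)) O :=
    (hψ.contMDiffOn_tangentMapWithin (m := ∞) le_rfl hO.uniqueMDiffOn).comp hconst.contMDiffOn
      fun y hy ↦ hy
  have happly := ContMDiffOn.clm_bundle_apply (IM := 𝓡 3) (IB := 𝓡 3) (b := ψ) (s := O)
    (F₁ := R3) (F₂ := ℝ) (E₁ := fun p : M ↦ TangentSpace (𝓡 3) p) (E₂ := Trivial M ℝ)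
    (ϕ := fun y ↦ η (ψ y)) (v := fun y ↦ mfderivWithin (𝓡 3) (𝓡 3) ψ O y v)
    (hη.comp_contMDiffOn hψ) htangent
  intro y hy
  refine (contMDiffWithinAt_totalSpace.mp (happly y hy)).2.contDiffWithinAt.congr_of_mem
    (fun z hz ↦ ?_) hy
  change η (ψ z) (mfderiv (𝓡 3) (𝓡 3) ψ z v) = η (ψ z) (mfderivWithin (𝓡 3) (𝓡 3) ψ O z v)
  rw [mfderivWithin_of_isOpen hO hz]

theorem OneForm.Smooth.contDiffOn_inChart {η : OneForm M} (hη : η.Smooth) (p : M) :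
    ContDiffOn ℝ ∞ (η.inChart p) (extChartAt (𝓡 3) p).target :=
  hη.contDiffOn_pullback (isOpen_extChartAt_target p) (contMDiffOn_extChartAt_symm p)

theorem OneForm.Smooth.differentiableAt_inChart {η : OneForm M} (hη : η.Smooth) (p : M) :
    DifferentiableAt ℝ (η.inChart p) (extChartAt (𝓡 3) p p) :=
  ((hη.contDiffOn_inChart p).contDiffAt (extChartAt_target_mem_nhds p)).differentiableAt (by simp)

theorem OneForm.Smooth.d_eq_curl_inChart {η : OneForm M} (hη : η.Smooth) (p : M)
    (v w : TangentSpace (𝓡 3) p) :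
    η.d p v w = curl (η.inChart p) (extChartAt (𝓡 3) p p)
      (mfderiv (𝓡 3) (𝓡 3) (extChartAt (𝓡 3) p) p v)
      (mfderiv (𝓡 3) (𝓡 3) (extChartAt (𝓡 3) p) p w) :=
  extDeriv_ofSubsingleton (hη.differentiableAt_inChart p) _ _

theorem fderiv_extChartAt_comp {ψ : R3 → M} {p : M} {z : R3}
    (hψ : MDifferentiableAt (𝓡 3) (𝓡 3) ψ z) (hz : ψ z ∈ (extChartAt (𝓡 3) p).source) (v : R3) :
    fderiv ℝ (fun z ↦ extChartAt (𝓡 3) p (ψ z)) z v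
      = mfderiv (𝓡 3) (𝓡 3) (extChartAt (𝓡 3) p) (ψ z) (mfderiv (𝓡 3) (𝓡 3) ψ z v) := by
  rw [← mfderiv_eq_fderiv]
  exact DFunLike.congr_fun (mfderiv_comp z (mdifferentiableAt_extChartAt (by simpa using hz)) hψ) v

theorem OneForm.Smooth.curl_pullback {η : OneForm M} (hη : η.Smooth) {ψ : R3 → M}
    {O : Set R3} (hO : IsOpen O) (hψ : ContMDiffOn (𝓡 3) (𝓡 3) ∞ ψ O) {y : R3} (hy : y ∈ O)
    (v w : R3) :
    curl (η.pullback ψ).coeff y v w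
      = η.d (ψ y) (mfderiv (𝓡 3) (𝓡 3) ψ y v) (mfderiv (𝓡 3) (𝓡 3) ψ y w) := by
  have hdiff : ∀ z ∈ O, MDifferentiableAt (𝓡 3) (𝓡 3) ψ z := fun z hz ↦
    (hψ.contMDiffAt (hO.mem_nhds hz)).mdifferentiableAt (by simp)
  have hchart : ContMDiffAt (𝓡 3) (𝓡 3) ∞ (fun z ↦ extChartAt (𝓡 3) (ψ y) (ψ z)) y :=
    (contMDiffAt_extChartAt (I := 𝓡 3) (x := ψ y)).comp y (hψ.contMDiffAt (hO.mem_nhds hy))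
  have hlocal : (η.pullback ψ).coeff =ᶠ[𝓝 y]
      fun z ↦ (η.inChart (ψ y) (extChartAt (𝓡 3) (ψ y) (ψ z))).comp
        (fderiv ℝ (fun z ↦ extChartAt (𝓡 3) (ψ y) (ψ z)) z) := by
    filter_upwards [hO.mem_nhds hy,
      (hdiff y hy).continuousAt (extChartAt_source_mem_nhds (I := 𝓡 3) (ψ y))] with z hzO hz
    ext v
    rw [ContinuousLinearMap.comp_apply, fderiv_extChartAt_comp (hdiff z hzO) hz]
    exact (η.inChart_mfderiv_extChartAt hz _).symm
  rw [hη.d_eq_curl_inChart, ← fderiv_extChartAt_comp (hdiff y hy) (mem_extChartAt_source _),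
    ← fderiv_extChartAt_comp (hdiff y hy) (mem_extChartAt_source _),
    ← curl_comp_fderiv (τ := fun z ↦ extChartAt (𝓡 3) (ψ y) (ψ z))
      (hη.differentiableAt_inChart (ψ y)) (hchart.contDiffAt.of_le (by norm_cast)),
    curl, curl, hlocal.fderiv_eq]

theorem OneForm.Smooth.d_smul {η : OneForm M} (hη : η.Smooth) {g : M → ℝ}
    (hg : ContMDiff (𝓡 3) 𝓘(ℝ, ℝ) ∞ g) (p : M) (v w : TangentSpace (𝓡 3) p) :
    OneForm.d (fun p ↦ g p • η p) p v w = g p * η.d p v w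
      + (differential g p v * η p w - differential g p w * η p v) := by
  set χ := extChartAt (𝓡 3) p
  have hG : ContMDiffAt (𝓡 3) 𝓘(ℝ, ℝ) ∞ (fun y ↦ g (χ.symm y)) (χ p) :=
    (hg.contMDiffAt (x := χ.symm (χ p))).comp (χ p)
      ((contMDiffOn_extChartAt_symm p).contMDiffAt (extChartAt_target_mem_nhds p))
  have hgχ : g =ᶠ[𝓝 p] (fun y ↦ g (χ.symm y)) ∘ χ := by
    filter_upwards [extChartAt_source_mem_nhds (I := 𝓡 3) p] with q hq
      using congrArg g (χ.left_inv hq).symm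
  have hdG (v : TangentSpace (𝓡 3) p) : fderiv ℝ (fun y ↦ g (χ.symm y)) (χ p)
      (mfderiv (𝓡 3) (𝓡 3) χ p v : R3) = differential g p v := by
    have hcomp := mfderiv_comp p (hG.mdifferentiableAt (by simp))
      (mdifferentiableAt_extChartAt (mem_chart_source R3 p))
    rw [← mfderiv_eq_fderiv]
    exact (DFunLike.congr_fun hcomp v).symm.trans (DFunLike.congr_fun hgχ.mfderiv_eq v).symm
  have hsmul : OneForm.Smooth (fun p ↦ g p • η p) := hg.smul_section hη
  rw [hsmul.d_eq_curl_inChart, hη.d_eq_curl_inChart]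
  refine (curl_smul (hG.contDiffAt.differentiableAt (by simp)) (hη.differentiableAt_inChart p)
    _ _).trans ?_
  rw [hdG, hdG, η.inChart_mfderiv_extChartAt (mem_extChartAt_source p),
    η.inChart_mfderiv_extChartAt (mem_extChartAt_source p), extChartAt_to_inv]

theorem OneForm.smooth_of_contDiff {η : OneForm R3} (hη : ContDiff ℝ ∞ η.coeff) : η.Smooth := by
  refine fun q ↦ (contMDiffAt_hom_bundle _).mpr ⟨contMDiffAt_id,
    hη.contMDiff.contMDiffAt.congr_of_eventuallyEq (Eventually.of_forall fun y ↦ ?_)⟩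
  ext v
  simp [ContinuousLinearMap.inCoordinates]
  rfl

theorem OneForm.Smooth.contDiff_coeff {η : OneForm R3} (hη : η.Smooth) :
    ContDiff ℝ ∞ η.coeff := by
  simpa only [η.pullback_id, contDiffOn_univ]
    using hη.contDiffOn_pullback isOpen_univ (ψ := id) contMDiffOn_id

theorem OneForm.Smooth.d_eq_curl {η : OneForm R3} (hη : η.Smooth) (q v w : R3) :
    η.d q v w = curl η.coeff q v w := by
  have hpull := hη.curl_pullback isOpen_univ (ψ := id) contMDiffOn_id (mem_univ q) v w
  rw [η.pullback_id, mfderiv_id] at hpull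
  exact hpull.symm

theorem OneForm.Smooth.smooth_pullback {η : OneForm M} (hη : η.Smooth) {ψ : R3 → M}
    (hψ : ContMDiff (𝓡 3) (𝓡 3) ∞ ψ) : (η.pullback ψ).Smooth :=
  OneForm.smooth_of_contDiff (contDiffOn_univ.mp
    (hη.contDiffOn_pullback isOpen_univ hψ.contMDiffOn))

theorem OneForm.Smooth.d_pullback {η : OneForm M} (hη : η.Smooth) {ψ : R3 → M}
    (hψ : ContMDiff (𝓡 3) (𝓡 3) ∞ ψ) (q v w : R3) :
    (η.pullback ψ).d q v w
      = η.d (ψ q) (mfderiv (𝓡 3) (𝓡 3) ψ q v) (mfderiv (𝓡 3) (𝓡 3) ψ q w) :=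
  ((hη.smooth_pullback hψ).d_eq_curl q v w).trans
    (hη.curl_pullback isOpen_univ hψ.contMDiffOn (mem_univ q) v w)

/-- A one-form that is locally the differential of smooth functions. -/
def OneForm.LocallyExact (η : OneForm M) : Prop :=
  ∀ p, ∃ U : Set M, IsOpen U ∧ p ∈ U ∧ ∃ g : M → ℝ, ContMDiffOn (𝓡 3) 𝓘(ℝ, ℝ) ∞ g U ∧
    ∀ q ∈ U, η q = differential g q

theorem OneForm.locallyExact_of_curl_eq_zero {η : OneForm M}
    (hη : ∀ p, ContDiffOn ℝ ∞ (η.inChart p) (extChartAt (𝓡 3) p).target)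
    (hcurl : ∀ p, ∀ y ∈ (extChartAt (𝓡 3) p).target, ∀ v w, curl (η.inChart p) y v w = 0) :
    η.LocallyExact := by
  intro p
  set χ := extChartAt (𝓡 3) p with hχ
  obtain ⟨r, hr, hball⟩ := Metric.isOpen_iff.mp (isOpen_extChartAt_target p) (χ p)
    (mem_extChartAt_target p)
  obtain ⟨f, hf⟩ := (convex_ball (χ p) r).exists_forall_hasFDerivAt_of_fderiv_symmetric
    Metric.isOpen_ball (((hη p).differentiableOn (by simp)).mono hball)
    (fun a ha x y ↦ sub_eq_zero.mp (hcurl p a (hball ha) x y))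
  have hfsmooth : ContDiffOn ℝ ∞ f (Metric.ball (χ p) r) := by
    rw [contDiffOn_infty_iff_fderiv_of_isOpen Metric.isOpen_ball]
    exact ⟨fun a ha ↦ (hf a ha).differentiableAt.differentiableWithinAt,
      ((hη p).mono hball).congr fun a ha ↦ (hf a ha).fderiv⟩
  refine ⟨χ.source ∩ χ ⁻¹' Metric.ball (χ p) r,
    (continuousOn_extChartAt p).isOpen_inter_preimage (isOpen_extChartAt_source p)
      Metric.isOpen_ball, ⟨mem_extChartAt_source p, Metric.mem_ball_self hr⟩, fun q ↦ f (χ q),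
      ?_, fun q hq ↦ ?_⟩
  · exact hfsmooth.contMDiffOn.comp (contMDiffOn_extChartAt.mono
      fun q hq ↦ by simpa [hχ] using hq.1) fun q hq ↦ hq.2
  · have hχq : MDifferentiableAt (𝓡 3) (𝓡 3) χ q :=
      mdifferentiableAt_extChartAt (by simpa [hχ] using hq.1)
    have hcomp := (HasMFDerivAt.comp q (hf _ hq.2).hasMFDerivAt hχq.hasMFDerivAt).mfderiv
    ext v
    exact (η.inChart_mfderiv_extChartAt hq.1 v).symm.trans (DFunLike.congr_fun hcomp v).symm

theorem OneForm.Smooth.locallyExact_pullback {N : Type*} [TopologicalSpace N] [ChartedSpace R3 N]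
    [IsManifold (𝓡 3) ∞ N] {η : OneForm M} (hη : η.Smooth) {f : N → M}
    (hf : ContMDiff (𝓡 3) (𝓡 3) ∞ f)
    (hd : ∀ p (v w : TangentSpace (𝓡 3) p), η.d (f p) (mfderiv (𝓡 3) (𝓡 3) f p v)
      (mfderiv (𝓡 3) (𝓡 3) f p w) = 0) : (η.pullback f).LocallyExact := by
  have hsymm (p : N) := contMDiffOn_extChartAt_symm (I := 𝓡 3) (n := ∞) p
  have hopen (p : N) := isOpen_extChartAt_target (I := 𝓡 3) p
  have hchain (p : N) (y : R3) (hy : y ∈ (extChartAt (𝓡 3) p).target) :=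
    mfderiv_comp y (I' := 𝓡 3) (hf.mdifferentiableAt (by simp))
      (((hsymm p).contMDiffAt ((hopen p).mem_nhds hy)).mdifferentiableAt (by simp))
  have heq (p : N) : EqOn ((η.pullback f).inChart p)
      (η.pullback (f ∘ (extChartAt (𝓡 3) p).symm)).coeff (extChartAt (𝓡 3) p).target :=
    fun y hy ↦ ContinuousLinearMap.ext fun v ↦
      congrArg (η _) (DFunLike.congr_fun (hchain p y hy) v).symm
  refine OneForm.locallyExact_of_curl_eq_zero (fun p ↦ ?_) (fun p y hy v w ↦ ?_)
  · exact (hη.contDiffOn_pullback (hopen p) (hf.comp_contMDiffOn (hsymm p))).congr (heq p)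
  · rw [curl, ((heq p).eventuallyEq_of_mem ((hopen p).mem_nhds hy)).fderiv_eq, ← curl,
      hη.curl_pullback (hopen p) (hf.comp_contMDiffOn (hsymm p)) hy, hchain p y hy]
    exact hd _ _ _

end OneForm

end PullbackOfOneForms

section ExactnessOfClosedForms

open Set

section Glue

variable {X A ι : Type*} [TopologicalSpace X] [AddCommGroup A] {U : ι → Set X} {g : ι → X → A}

/-- The bundle over `X` glued from the products `U i × A`, `A` discrete, along the translations by
`g i - g j`. A section is the same as a function on `X` that differs from every `g i` by a locally
constant function. -/
def translationBundle [TopologicalSpace A] [DiscreteTopology A] (hU : ∀ i, IsOpen (U i))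
    (idx : X → ι) (hidx : ∀ p, p ∈ U (idx p))
    (hg : ∀ i j, ∀ p ∈ U i ∩ U j, ∀ᶠ q in 𝓝 p, g i q - g j q = g i p - g j p) :
    FiberBundleCore ι X A where
  baseSet := U
  isOpen_baseSet := hU
  indexAt := idx
  mem_baseSet_at := hidx
  coordChange i j p a := a + (g i p - g j p)
  coordChange_self _ _ _ _ := by simp
  continuousOn_coordChange := by
    rintro i j ⟨p, a⟩ ⟨hp, -⟩
    have hsnd : ∀ᶠ z : X × A in 𝓝 (p, a), z.2 = a :=
      (continuousAt_snd (p := (p, a))).eventually (p := (· = a)) (by simp)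
    have hfst : ∀ᶠ z : X × A in 𝓝 (p, a), g i z.1 - g j z.1 = g i p - g j p :=
      (continuousAt_fst (p := (p, a))).eventually (hg i j p hp)
    refine (continuousAt_const.congr (f := fun _ ↦ a + (g i p - g j p)) ?_).continuousWithinAt
    filter_upwards [hsnd, hfst] with z hz₂ hz₁
    rw [hz₁, hz₂]
  coordChange_comp _ _ _ _ _ _ := by abel

theorem exists_eventually_sub_eq_of_simplyConnected [SimplyConnectedSpace X]
    [LocallyPathConnectedSpace X] (hU : ∀ i, IsOpen (U i)) (hcover : ∀ p, ∃ i, p ∈ U i)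
    (hg : ∀ i j, ∀ p ∈ U i ∩ U j, ∀ᶠ q in 𝓝 p, g i q - g j q = g i p - g j p) :
    ∃ G : X → A, ∀ i, ∀ p ∈ U i, ∀ᶠ q in 𝓝 p, G q - g i q = G p - g i p := by
  let _ : TopologicalSpace A := ⊥
  have : DiscreteTopology A := ⟨rfl⟩
  choose idx hidx using hcover
  let Z := translationBundle hU idx hidx hg
  have hcov : IsCoveringMap Z.proj := IsFiberBundle.isCoveringMap fun p ↦ ⟨Z.localTriv (idx p),
    hidx p⟩
  obtain ⟨p₀⟩ : Nonempty X := inferInstance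
  obtain ⟨σ, ⟨-, hσ⟩, -⟩ := hcov.existsUnique_continuousMap_lifts (ContinuousMap.id X) p₀
    ⟨p₀, (0 : A)⟩ rfl
  have hproj (q : X) : (σ q).1 = q := congrFun hσ q
  let G (z : Z.TotalSpace) : A := (show A from z.2) + g (idx z.1) z.1
  refine ⟨fun q ↦ G (σ q), fun i p hp ↦ ?_⟩
  have htriv (z : Z.TotalSpace) : (Z.localTriv i z).2 = G z - g i z.1 :=
    (add_sub_assoc (show A from z.2) _ _).symm
  have hcoord (q : X) : (Z.localTriv i (σ q)).2 = G (σ q) - g i q :=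
    (htriv (σ q)).trans (congrArg (fun p ↦ G (σ q) - g i p) (hproj q))
  have hcont : ContinuousAt (fun q ↦ (Z.localTriv i (σ q)).2) p := by
    refine continuousAt_snd.comp (((Z.localTriv i).continuousAt ?_).comp σ.continuous.continuousAt)
    rw [(Z.localTriv i).mem_source]
    exact (congrArg (· ∈ U i) (hproj p)).mpr hp
  filter_upwards [hcont (show {(Z.localTriv i (σ p)).2} ∈ 𝓝 _ by simp)] with q hq
  rw [← hcoord, ← hcoord]
  exact hq

end Glue

variable {M : Type*} [TopologicalSpace M] [ChartedSpace R3 M] [IsManifold (𝓡 3) ∞ M]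

theorem eventually_eq_of_differential_eq_zero {h : M → ℝ} {U : Set M} (hU : IsOpen U)
    (hh : ContMDiffOn (𝓡 3) 𝓘(ℝ, ℝ) ∞ h U) (hzero : ∀ q ∈ U, differential h q = 0)
    {p : M} (hp : p ∈ U) : ∀ᶠ q in 𝓝 p, h q = h p := by
  set χ := extChartAt (𝓡 3) p
  have hχp : χ.symm (χ p) = p := extChartAt_to_inv p
  have hnear : ∀ᶠ y in 𝓝 (χ p), y ∈ χ.target ∧ χ.symm y ∈ U :=
    (show ∀ᶠ y in 𝓝 (χ p), y ∈ χ.target from extChartAt_target_mem_nhds p).and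
      ((continuousAt_extChartAt_symm p).tendsto (hχp.symm ▸ hU.mem_nhds hp))
  obtain ⟨r, hr, hball⟩ := Metric.eventually_nhds_iff_ball.mp hnear
  have hderiv : ∀ y ∈ Metric.ball (χ p) r,
      HasFDerivAt (fun y ↦ h (χ.symm y)) (0 : R3 →L[ℝ] ℝ) y := by
    intro y hy
    obtain ⟨hytarget, hyU⟩ := hball y hy
    have hsymm : MDifferentiableAt (𝓡 3) (𝓡 3) χ.symm y :=
      ((contMDiffOn_extChartAt_symm (n := ∞) p).contMDiffAt
        ((isOpen_extChartAt_target p).mem_nhds hytarget)).mdifferentiableAt (by simp)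
    have hhy : MDifferentiableAt (𝓡 3) 𝓘(ℝ, ℝ) h (χ.symm y) :=
      (hh.contMDiffAt (hU.mem_nhds hyU)).mdifferentiableAt (by simp)
    refine ((hhy.hasMFDerivAt.comp y hsymm.hasMFDerivAt).congr_mfderiv ?_).hasFDerivAt
    exact ContinuousLinearMap.ext fun v ↦ DFunLike.congr_fun (hzero _ hyU) _
  have hconst : ∀ y ∈ Metric.ball (χ p) r, h (χ.symm y) = h p := fun y hy ↦
    ((convex_ball (χ p) r).is_const_of_fderivWithin_eq_zero (𝕜 := ℝ)
      (fun z hz ↦ (hderiv z hz).differentiableAt.differentiableWithinAt)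
      (fun z hz ↦ (fderivWithin_of_isOpen Metric.isOpen_ball hz).trans (hderiv z hz).fderiv)
      hy (Metric.mem_ball_self hr)).trans (congrArg h hχp)
  filter_upwards [extChartAt_source_mem_nhds (I := 𝓡 3) p,
    (continuousAt_extChartAt (I := 𝓡 3) p) (Metric.ball_mem_nhds _ hr)] with q hqsource hqball
  exact (congrArg h (χ.left_inv hqsource)).symm.trans (hconst (χ q) hqball)

theorem OneForm.LocallyExact.exists_eq_differential [SimplyConnectedSpace M] {η : OneForm M}
    (hη : η.LocallyExact) :
    ∃ g : M → ℝ, ContMDiff (𝓡 3) 𝓘(ℝ, ℝ) ∞ g ∧ η = differential g := by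
  choose U hU hmem g hg hηg using hη
  have hmdiff (i q : M) (hq : q ∈ U i) : MDifferentiableAt (𝓡 3) 𝓘(ℝ, ℝ) (g i) q :=
    ((hg i).contMDiffAt ((hU i).mem_nhds hq)).mdifferentiableAt (by simp)
  have htransition (i j : M) : ∀ p ∈ U i ∩ U j, ∀ᶠ q in 𝓝 p, g i q - g j q = g i p - g j p := by
    refine fun p hp ↦ eventually_eq_of_differential_eq_zero (h := fun q ↦ g i q - g j q)
      ((hU i).inter (hU j)) (((hg i).mono inter_subset_left).sub ((hg j).mono inter_subset_right))
      (fun q hq ↦ ?_) hp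
    refine ((hmdiff i q hq.1).hasMFDerivAt.sub (hmdiff j q hq.2).hasMFDerivAt).mfderiv.trans ?_
    exact sub_eq_zero.mpr ((hηg i q hq.1).symm.trans (hηg j q hq.2))
  have : LocallyPathConnectedSpace M := ChartedSpace.locallyPathConnectedSpace R3 M
  obtain ⟨G, hG⟩ := exists_eventually_sub_eq_of_simplyConnected hU (fun p ↦ ⟨p, hmem p⟩) htransition
  have hlocal (p : M) : G =ᶠ[𝓝 p] fun q ↦ (G p - g p p) + g p q := by
    filter_upwards [hG p p (hmem p)] with q hq
    exact sub_eq_iff_eq_add.mp hq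
  refine ⟨G, fun p ↦ ?_, funext fun p ↦ ?_⟩
  · exact (contMDiffAt_const.add ((hg p).contMDiffAt
      ((hU p).mem_nhds (hmem p)))).congr_of_eventuallyEq (hlocal p)
  · have hsum := ((hasMFDerivAt_const (I := 𝓡 3) (I' := 𝓘(ℝ, ℝ)) (G p - g p p) p).add
      (hmdiff p p (hmem p)).hasMFDerivAt).mfderiv
    rw [differential, (hlocal p).mfderiv_eq]
    exact (hηg p p (hmem p)).trans ((zero_add _).symm.trans hsum.symm)

end ExactnessOfClosedForms

/-! ### Completeness of the dual frame -/

section DualFrame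

open Set

theorem contDiffAt_inverse_pi {E ι : Type*} [NormedAddCommGroup E] [NormedSpace ℝ E]
    [FiniteDimensional ℝ E] [Fintype ι] {n : WithTop ℕ∞} {a : ι → E →L[ℝ] ℝ}
    (ha : (ContinuousLinearMap.pi a).IsInvertible) :
    ContDiffAt ℝ n (fun b : ι → E →L[ℝ] ℝ ↦ (ContinuousLinearMap.pi b).inverse) a := by
  have : CompleteSpace E := FiniteDimensional.complete ℝ E
  have hpi : ContDiff ℝ n (fun b : ι → E →L[ℝ] ℝ ↦ ContinuousLinearMap.pi b) :=
    contDiff_clm_apply_iff.mpr fun v ↦ contDiff_pi.mpr fun i ↦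
      (contDiff_apply ℝ (E →L[ℝ] ℝ) i).clm_apply contDiff_const
  obtain ⟨L, hL⟩ := ha
  refine ContDiffAt.comp a (g := ContinuousLinearMap.inverse) ?_ hpi.contDiffAt
  rw [← hL]
  exact contDiffAt_map_inverse L

variable {M : Type*} [TopologicalSpace M] [ChartedSpace R3 M] [IsManifold (𝓡 3) ∞ M]

set_option synthInstance.maxHeartbeats 100000 in
-- Instances on `T →L[ℝ] T →L[ℝ] ℝ` are searched through the unfolding of `TangentSpace`.
theorem OneForm.Smooth.smulRight {η ζ : OneForm M} (hη : η.Smooth) (hζ : ζ.Smooth) :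
    TwoTensor.Smooth (fun p ↦ (η p).smulRight (ζ p)) := by
  intro p₀
  have hηcoord := ((contMDiffAt_hom_bundle _).mp (hη p₀)).2
  have hζcoord := ((contMDiffAt_hom_bundle _).mp (hζ p₀)).2
  have hbilin : ContDiff ℝ ∞ (fun z : (R3 →L[ℝ] ℝ) × (R3 →L[ℝ] ℝ) ↦ z.1.smulRight z.2) :=
    isBoundedBilinearMap_smulRight.contDiff
  refine (contMDiffAt_hom_bundle _).mpr ⟨contMDiffAt_id,
    (hbilin.contMDiff.contMDiffAt.comp p₀ (hηcoord.prodMk_space hζcoord)).congr_of_eventuallyEq ?_⟩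
  filter_upwards [(chartAt R3 p₀).open_source.mem_nhds (mem_chart_source R3 p₀)] with q hq
  ext v w
  simp [ContinuousLinearMap.inCoordinates, hom_trivializationAt_apply,
    Trivialization.continuousLinearMapAt_apply_of_mem, hq]

namespace Coframe

/-- The isomorphism of the tangent space at `p` with `ℝ³` given by the coframe. -/
def equivAt (e : Coframe M) (p : M) : TangentSpace (𝓡 3) p ≃L[ℝ] (Fin 3 → ℝ) :=
  (LinearEquiv.ofBijective (LinearMap.pi fun i ↦ (show R3 →L[ℝ] ℝ from e.form i p).toLinearMap)
    (e.bijective p)).toContinuousLinearEquiv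

theorem equivAt_apply (e : Coframe M) (i : Fin 3) (p : M) (v : TangentSpace (𝓡 3) p) :
    e.equivAt p v i = e.form i p v := rfl

theorem form_injective (e : Coframe M) {p : M} {v w : TangentSpace (𝓡 3) p}
    (h : ∀ i, e.form i p v = e.form i p w) : v = w :=
  (e.bijective p).injective (funext h)

theorem eq_sharp (e : Coframe M) {p : M} {v : TangentSpace (𝓡 3) p} {j : Fin 3}
    (h : ∀ i, e.form i p v = if i = j then 1 else 0) : v = e.sharp j p :=
  e.form_injective fun i ↦ by rw [h, e.form_sharp]

theorem equivAt_symm_single (e : Coframe M) (j : Fin 3) (p : M) :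
    (e.equivAt p).symm (Pi.single j 1) = e.sharp j p :=
  e.eq_sharp fun i ↦ by
    rw [← equivAt_apply, ContinuousLinearEquiv.apply_symm_apply, Pi.single_apply]

theorem contMDiff_sharp (e : Coframe M) (j : Fin 3) :
    ContMDiff (𝓡 3) (𝓡 3).tangent ∞
      (fun p ↦ (⟨p, e.sharp j p⟩ : TangentBundle (𝓡 3) M)) := by
  intro p₀
  let t := trivializationAt R3 (TangentSpace (𝓡 3) : M → Type) p₀
  let a (q : M) (i : Fin 3) : R3 →L[ℝ] ℝ := ContinuousLinearMap.inCoordinates R3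
    (TangentSpace (𝓡 3) : M → Type) ℝ (Trivial M ℝ) p₀ q p₀ q (e.form i q)
  have ha : ContMDiffAt (𝓡 3) 𝓘(ℝ, Fin 3 → R3 →L[ℝ] ℝ) ∞ a p₀ :=
    contMDiffAt_pi_space.mpr fun i ↦ ((contMDiffAt_hom_bundle _).mp (e.smooth i p₀)).2
  have hcoord (q : M) (hq : q ∈ t.baseSet) : ((t.continuousLinearEquivAt ℝ q hq).symm.trans
      (e.equivAt q) : R3 →L[ℝ] (Fin 3 → ℝ)) = ContinuousLinearMap.pi (a q) := by
    ext v i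
    simpa [a, ContinuousLinearMap.inCoordinates, equivAt_apply, t] using
      congrArg (e.form i q) (t.symmL_apply hq v).symm
  have hp₀ : p₀ ∈ t.baseSet := FiberBundle.mem_baseSet_trivializationAt' p₀
  have hinv : ContDiffAt ℝ ∞ (fun b ↦ (ContinuousLinearMap.pi b).inverse) (a p₀) :=
    contDiffAt_inverse_pi ⟨_, hcoord p₀ hp₀⟩
  refine (contMDiffAt_section _).mpr (((hinv.contMDiffAt.comp p₀ ha).clm_apply
    (contMDiffAt_const (c := Pi.single j 1))).congr_of_eventuallyEq ?_)
  filter_upwards [t.open_baseSet.mem_nhds hp₀] with q hq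
  simp only [Function.comp_apply]
  rw [← hcoord q hq, ContinuousLinearMap.inverse_equiv]
  exact congrArg (t.continuousLinearEquivAt ℝ q hq) (e.equivAt_symm_single j q).symm

theorem abs_form_le (e : Coframe M) (i : Fin 3) {p : M} (v : TangentSpace (𝓡 3) p) :
    |e.form i p v| ≤ Real.sqrt (e.metric p v v) := by
  refine Real.abs_le_sqrt ?_
  rw [sq]
  exact Finset.single_le_sum (f := fun i ↦ e.form i p v * e.form i p v)
    (fun _ _ ↦ mul_self_nonneg _) (Finset.mem_univ i)

theorem metric_pos (e : Coframe M) {p : M} {v : TangentSpace (𝓡 3) p} (hv : v ≠ 0) :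
    0 < e.metric p v v := by
  by_contra! hle
  refine hv (e.form_injective fun i ↦ ?_)
  simpa [Real.sqrt_eq_zero_of_nonpos hle] using e.abs_form_le i v

theorem metric_sharp_self (e : Coframe M) (j : Fin 3) (p : M) :
    e.metric p (e.sharp j p) (e.sharp j p) = 1 := by
  simp [metric, form_sharp]

theorem isVonNBounded_metric_lt_one (e : Coframe M) (p : M) :
    Bornology.IsVonNBounded ℝ {v : TangentSpace (𝓡 3) p | e.metric p v v < 1} := by
  have hball : Bornology.IsVonNBounded ℝ (Metric.closedBall (0 : Fin 3 → ℝ) 1) :=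
    NormedSpace.isVonNBounded_closedBall ℝ _ 1
  let L : R3 ≃L[ℝ] (Fin 3 → ℝ) := e.equivAt p
  refine (hball.image (L.symm : (Fin 3 → ℝ) →L[ℝ] R3)).subset
    fun v hv ↦ (mem_image _ _ _).mpr ⟨L v, ?_, L.symm_apply_apply v⟩
  exact mem_closedBall_zero_iff.mpr ((pi_norm_le_iff_of_nonneg zero_le_one).mpr fun i ↦
    (e.abs_form_le i v).trans (Real.sqrt_le_one.mpr (le_of_lt hv)))

set_option synthInstance.maxHeartbeats 100000 in
-- Instances on `T →L[ℝ] T →L[ℝ] ℝ` are searched through the unfolding of `TangentSpace`.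
/-- The metric `h_e` as a smooth Riemannian metric on the tangent bundle, which gives access to
Mathlib's theory of Riemannian manifolds. -/
def riemannianMetric (e : Coframe M) :
    ContMDiffRiemannianMetric (𝓡 3) ∞ R3 (fun p : M ↦ TangentSpace (𝓡 3) p) where
  inner p := ∑ i, (e.form i p).smulRight (e.form i p)
  symm p v w := by simp [mul_comm]
  pos p v hv := by simpa [metric] using e.metric_pos hv
  isVonNBounded p := by simpa [metric] using e.isVonNBounded_metric_lt_one p
  contMDiff := ContMDiff.sum_section fun i _ ↦ (e.smooth i).smulRight (e.smooth i)

theorem riemannianMetric_inner (e : Coframe M) {p : M} (v w : TangentSpace (𝓡 3) p) :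
    e.riemannianMetric.inner p v w = e.metric p v w := by
  simp [riemannianMetric, metric]

/-- The inner products `h_e` on the tangent spaces. They depend on the coframe, so this is not
an instance. -/
abbrev riemannianBundle (e : Coframe M) : RiemannianBundle (fun p : M ↦ TangentSpace (𝓡 3) p) :=
  ⟨e.riemannianMetric.toRiemannianMetric⟩

theorem enorm_eq_sqrt_metric (e : Coframe M) {p : M} (v : TangentSpace (𝓡 3) p) :
    let _ := e.riemannianBundle
    ‖v‖ₑ = ENNReal.ofReal (Real.sqrt (e.metric p v v)) := by
  intro _
  rw [← ofReal_norm, norm_eq_sqrt_real_inner, ← e.riemannianMetric_inner]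
  rfl

theorem dist_eq_riemannianEDist (e : Coframe M) (p q : M) :
    let _ := e.riemannianBundle
    e.dist p q = Manifold.riemannianEDist (𝓡 3) p q := by
  intro _
  have henorm : (fun x : M ↦ (⟨fun v ↦ ENNReal.ofReal (Real.sqrt (e.metric x v v))⟩ :
      ENorm (TangentSpace (𝓡 3) x))) = fun x ↦ ⟨fun v ↦ ‖v‖ₑ⟩ :=
    funext fun x ↦ congrArg ENorm.mk (funext fun v ↦ (e.enorm_eq_sqrt_metric v).symm)
  rw [Coframe.dist, henorm]

theorem dist_comm (e : Coframe M) (p q : M) : e.dist p q = e.dist q p := by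
  let _ := e.riemannianBundle
  rw [e.dist_eq_riemannianEDist, e.dist_eq_riemannianEDist, Manifold.riemannianEDist_comm]

theorem exists_dist_lt_imp_mem [T2Space M] (e : Coframe M) {p : M} {U : Set M} (hU : U ∈ 𝓝 p) :
    ∃ c > 0, ∀ q, e.dist p q < c → q ∈ U := by
  let _ := e.riemannianBundle
  have : IsContinuousRiemannianBundle R3 (fun p : M ↦ TangentSpace (𝓡 3) p) :=
    ⟨e.riemannianMetric.inner, e.riemannianMetric.contMDiff.continuous, fun _ _ _ ↦ rfl⟩
  have : LocallyCompactSpace M := Manifold.locallyCompact_of_finiteDimensional (𝓡 3)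
  obtain ⟨c, hc, hcU⟩ := setOfPred_riemannianEDist_lt_subset_nhds' (𝓡 3) hU
  exact ⟨c, hc, fun q hq ↦ hcU ((e.dist_eq_riemannianEDist p q).symm.trans_lt hq)⟩

end Coframe

end DualFrame

section CompletenessOfFlows

open Set Filter

section IntegralCurve

variable {E : Type*} [NormedAddCommGroup E] [NormedSpace ℝ E]
  {M : Type*} [TopologicalSpace M] [ChartedSpace E M] [IsManifold 𝓘(ℝ, E) 1 M]
  {X : (p : M) → TangentSpace 𝓘(ℝ, E) p}

theorem contMDiffOn_of_isMIntegralCurveOn [CompleteSpace E] [HasContDiffBump E]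
    (hX : ContMDiff 𝓘(ℝ, E) 𝓘(ℝ, E).tangent 1 (fun p ↦ (⟨p, X p⟩ : TangentBundle 𝓘(ℝ, E) M)))
    {γ : ℝ → M} {s : Set ℝ} (hs : IsOpen s) (hγ : IsMIntegralCurveOn γ X s) :
    ContMDiffOn 𝓘(ℝ, ℝ) 𝓘(ℝ, E) 1 γ s := by
  have : IsManifold 𝓘(ℝ, E) ((1 : ℕ) : WithTop ℕ∞) M := by simpa
  intro t ht
  obtain ⟨β, hβsmooth, hβ0, hβ⟩ := exists_contMDiffAt_flow one_ne_zero (by exact_mod_cast hX (γ t))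
  have hflow : IsMIntegralCurveAt (fun s ↦ β (γ t, s - t)) X t := by
    have hβt : IsMIntegralCurveAt (fun s ↦ β (γ t, s)) X 0 :=
      (show ContinuousAt (fun s : ℝ ↦ (γ t, s)) 0 by fun_prop).eventually hβ
    simpa [Function.comp_def, sub_eq_add_neg] using hβt.comp_add (-t)
  have hsmooth : ContMDiffAt 𝓘(ℝ, ℝ) 𝓘(ℝ, E) 1 (fun s ↦ β (γ t, s - t)) t := by
    have hβt : ContMDiffAt (𝓘(ℝ, E).prod 𝓘(ℝ, ℝ)) 𝓘(ℝ, E) 1 β (γ t, t - t) := by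
      rw [sub_self]
      exact_mod_cast hβsmooth.self_of_nhds
    exact hβt.comp (f := fun s : ℝ ↦ (γ t, s - t)) t (contMDiffAt_const.prodMk
      (contDiff_id.sub contDiff_const).contMDiff.contMDiffAt)
  exact (hsmooth.congr_of_eventuallyEq
    (isMIntegralCurveAt_eventuallyEq_of_contMDiffAt_boundaryless (hX (γ t))
      (hγ.isMIntegralCurveAt (hs.mem_nhds ht)) hflow
      (by simpa using hβ0.self_of_nhds.symm))).contMDiffWithinAt

variable [T2Space M]

theorem exists_isMIntegralCurveOn_union
    (hX : ContMDiff 𝓘(ℝ, E) 𝓘(ℝ, E).tangent 1 (fun p ↦ (⟨p, X p⟩ : TangentBundle 𝓘(ℝ, E) M)))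
    {γ γ' : ℝ → M} {a b t₀ ε : ℝ} (hγ : IsMIntegralCurveOn γ X (Ioo a b))
    (hγ' : IsMIntegralCurveOn γ' X (Ioo (-ε) ε)) (ht₀ : t₀ ∈ Ioo a b) (hε : 0 < ε)
    (h : γ' 0 = γ t₀) :
    ∃ σ : ℝ → M, EqOn σ γ (Ioo a b) ∧ IsMIntegralCurveOn σ X (Ioo a b ∪ Ioo (t₀ - ε) (t₀ + ε)) := by
  have hshift : IsMIntegralCurveOn (γ' ∘ (· - t₀)) X (Ioo (t₀ - ε) (t₀ + ε)) := by
    refine (isMIntegralCurveOn_comp_sub.mpr hγ').mono fun t ht ↦ ⟨?_, ?_⟩ <;>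
      linarith [ht.1, ht.2]
  exact ⟨piecewise (Ioo a b) γ (γ' ∘ (· - t₀)), piecewise_eqOn _ _ _,
    isMIntegralCurveOn_piecewise hX hγ hshift ⟨ht₀, by linarith, by linarith⟩ (by simp [h])⟩

theorem exists_isMIntegralCurveOn_extend [CompleteSpace E] [HasContDiffBump E]
    (hX : ContMDiff 𝓘(ℝ, E) 𝓘(ℝ, E).tangent 1 (fun p ↦ (⟨p, X p⟩ : TangentBundle 𝓘(ℝ, E) M)))
    {γ : ℝ → M} {a b t₀ : ℝ} (hγ : IsMIntegralCurveOn γ X (Ioo a b)) {q : M}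
    (hq : MapClusterPt q (𝓝[Ioo a b] t₀) γ) :
    ∃ δ > 0, ∃ σ : ℝ → M, EqOn σ γ (Ioo a b) ∧
      IsMIntegralCurveOn σ X (Ioo a b ∪ Ioo (t₀ - δ) (t₀ + δ)) := by
  obtain ⟨ε, hε, hcurves⟩ := exists_eventually_isMIntegralCurveOn (hX q)
  have hnear : ∀ᶠ s in 𝓝[Ioo a b] t₀, s ∈ Ioo a b ∧ s ∈ Ioo (t₀ - ε / 2) (t₀ + ε / 2) :=
    eventually_mem_nhdsWithin.and
      (nhdsWithin_le_nhds (Ioo_mem_nhds (by linarith) (by linarith)))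
  obtain ⟨s, ⟨γ', hγ's, hγ'⟩, hs, hst₀⟩ := ((hq.frequently hcurves).and_eventually hnear).exists
  obtain ⟨σ, hσγ, hσ⟩ := exists_isMIntegralCurveOn_union hX hγ hγ' hs hε hγ's
  refine ⟨ε / 2, half_pos hε, σ, hσγ, hσ.mono (union_subset_union_right _ (Ioo_subset_Ioo ?_ ?_))⟩
  · linarith [hst₀.2]
  · linarith [hst₀.1]

theorem exists_isMIntegralCurveOn_of_forall_lt
    (hX : ContMDiff 𝓘(ℝ, E) 𝓘(ℝ, E).tangent 1 (fun p ↦ (⟨p, X p⟩ : TangentBundle 𝓘(ℝ, E) M)))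
    {x : M} {A : ℝ} (hA : 0 < A)
    (h : ∀ a < A, ∃ γ : ℝ → M, γ 0 = x ∧ IsMIntegralCurveOn γ X (Ioo (-a) a)) :
    ∃ γ : ℝ → M, γ 0 = x ∧ IsMIntegralCurveOn γ X (Ioo (-A) A) := by
  have : Nonempty M := ⟨x⟩
  choose! γ hγ0 hγ using h
  have hagree {a b t : ℝ} (hab : a ≤ b) (hb : b < A) (ht : |t| < a) : γ a t = γ b t :=
    isMIntegralCurveOn_Ioo_eqOn_of_contMDiff_boundaryless (t₀ := 0)
      (by simpa using (abs_nonneg t).trans_lt ht) hX (hγ a (hab.trans_lt hb))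
      ((hγ b hb).mono (Ioo_subset_Ioo (neg_le_neg hab) hab))
      (by rw [hγ0 a (hab.trans_lt hb), hγ0 b hb]) (abs_lt.mp ht)
  refine ⟨fun t ↦ γ ((|t| + A) / 2) t, hγ0 _ (by simpa using hA), fun t ht ↦ ?_⟩
  obtain ⟨a, hta, haA⟩ := exists_between (show (|t| + A) / 2 < A by linarith [abs_lt.mpr ht])
  have hmem : Ioo (-a) a ∈ 𝓝 t :=
    (abs_lt.mp (by linarith [abs_lt.mpr ht])).elim Ioo_mem_nhds
  have hlt : ∀ᶠ r in 𝓝 t, (|r| + A) / 2 < a :=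
    (show Continuous fun r : ℝ ↦ (|r| + A) / 2 by fun_prop).continuousAt.eventually_lt_const hta
  refine HasMFDerivAt.hasMFDerivWithinAt ?_
  have heq : (fun t ↦ γ ((|t| + A) / 2) t) =ᶠ[𝓝 t] γ a := by
    filter_upwards [hlt, Ioo_mem_nhds ht.1 ht.2] with r hr hrA
    exact hagree hr.le haA (by linarith [abs_lt.mpr hrA])
  have := (hγ a haA t (mem_of_mem_nhds hmem)).hasMFDerivAt hmem
  rw [← heq.self_of_nhds] at this
  exact this.congr_of_eventuallyEq heq

theorem exists_isMIntegralCurve_of_mapClusterPt [CompleteSpace E] [HasContDiffBump E]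
    (hX : ContMDiff 𝓘(ℝ, E) 𝓘(ℝ, E).tangent 1 (fun p ↦ (⟨p, X p⟩ : TangentBundle 𝓘(ℝ, E) M)))
    (hcluster : ∀ (γ : ℝ → M) (a b : ℝ), IsMIntegralCurveOn γ X (Ioo a b) →
      ∀ t ∈ closure (Ioo a b), ∃ q, MapClusterPt q (𝓝[Ioo a b] t) γ)
    (x : M) : ∃ γ : ℝ → M, γ 0 = x ∧ IsMIntegralCurve γ X := by
  let s := {a | ∃ γ : ℝ → M, γ 0 = x ∧ IsMIntegralCurveOn γ X (Ioo (-a) a)}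
  have hmono {a b : ℝ} (hb : b ∈ s) (hab : a ≤ b) : a ∈ s :=
    hb.imp fun _ hγ ↦ ⟨hγ.1, hγ.2.mono (Ioo_subset_Ioo (neg_le_neg hab) hab)⟩
  by_cases hbdd : BddAbove s
  swap
  · refine (exists_isMIntegralCurve_iff_exists_isMIntegralCurveOn_Ioo hX x).mpr fun a ↦ ?_
    obtain ⟨b, hb, hab⟩ := not_bddAbove_iff.mp hbdd a
    exact hmono hb hab.le
  exfalso
  obtain ⟨ε, hε, hcurves⟩ := exists_eventually_isMIntegralCurveOn (hX x)
  have hεs : ε ∈ s := hcurves.self_of_nhds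
  let A := sSup s
  have hA : 0 < A := hε.trans_le (le_csSup hbdd hεs)
  obtain ⟨γ, hγ0, hγ⟩ := exists_isMIntegralCurveOn_of_forall_lt hX hA fun a ha ↦
    let ⟨b, hb, hab⟩ := exists_lt_of_lt_csSup ⟨ε, hεs⟩ ha
    hmono hb hab.le
  obtain ⟨q, hq⟩ := hcluster γ _ _ hγ A (by
    rw [closure_Ioo (by linarith)]; exact right_mem_Icc.mpr (by linarith))
  obtain ⟨δ, hδ, σ, hσγ, hσ⟩ := exists_isMIntegralCurveOn_extend hX hγ hq
  replace hσ := hσ.mono (Ioo_subset_Ioo_union_Ioo le_rfl (by linarith) le_rfl)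
  obtain ⟨q', hq'⟩ := hcluster σ _ _ hσ (-A) (by
    rw [closure_Ioo (by linarith)]; exact left_mem_Icc.mpr (by linarith))
  obtain ⟨δ', hδ', τ, hτσ, hτ⟩ := exists_isMIntegralCurveOn_extend hX hσ hq'
  have hmem : A + min δ δ' ∈ s := by
    refine ⟨τ, ?_, hτ.mono ?_⟩
    · rw [hτσ ⟨by linarith, by linarith⟩, hσγ ⟨by linarith, hA⟩, hγ0]
    · rw [union_comm]
      exact Ioo_subset_Ioo_union_Ioo (by linarith [min_le_right δ δ']) (by linarith)
        (by linarith [min_le_left δ δ'])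
  exact (le_csSup hbdd hmem).not_gt (lt_add_of_pos_right A (lt_min hδ hδ'))

end IntegralCurve

namespace Coframe

open Manifold MeasureTheory

variable {M : Type*} [TopologicalSpace M] [ChartedSpace R3 M] [IsManifold (𝓡 3) ∞ M]

theorem dist_le_of_isMIntegralCurveOn (e : Coframe M) (j : Fin 3) {γ : ℝ → M} {U : Set ℝ}
    (hU : IsOpen U) (hγ : IsMIntegralCurveOn γ (e.sharp j) U) {s t : ℝ} (hst : s ≤ t)
    (hsub : Icc s t ⊆ U) :
    e.dist (γ s) (γ t) ≤ ENNReal.ofReal (t - s) := by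
  let _ := e.riemannianBundle
  have hsmooth : ContMDiffOn 𝓘(ℝ, ℝ) (𝓡 3) 1 γ (Icc s t) :=
    (contMDiffOn_of_isMIntegralCurveOn ((e.contMDiff_sharp j).of_le (by norm_cast)) hU hγ).mono hsub
  have hspeed {r : ℝ} (hr : r ∈ Icc s t) : ‖mfderiv 𝓘(ℝ, ℝ) (𝓡 3) γ r 1‖ₑ = 1 := by
    have hderiv : mfderiv 𝓘(ℝ, ℝ) (𝓡 3) γ r 1 = e.sharp j (γ r) := by
      rw [((hγ r (hsub hr)).hasMFDerivAt (hU.mem_nhds (hsub hr))).mfderiv]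
      exact one_smul ℝ (e.sharp j (γ r))
    rw [e.enorm_eq_sqrt_metric, hderiv, metric_sharp_self, Real.sqrt_one, ENNReal.ofReal_one]
  calc e.dist (γ s) (γ t) ≤ pathELength (𝓡 3) γ s t := by
        rw [e.dist_eq_riemannianEDist]
        exact riemannianEDist_le_pathELength hsmooth rfl rfl hst
    _ = ∫⁻ _ in Icc s t, 1 := by
        rw [pathELength_eq_lintegral_mfderiv_Icc]
        exact setLIntegral_congr_fun measurableSet_Icc fun r hr ↦ hspeed hr
    _ = ENNReal.ofReal (t - s) := by simp

theorem dist_le_edist_of_isMIntegralCurveOn (e : Coframe M) (j : Fin 3) {γ : ℝ → M} {a b s t : ℝ}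
    (hγ : IsMIntegralCurveOn γ (e.sharp j) (Ioo a b)) (hs : s ∈ Ioo a b) (ht : t ∈ Ioo a b) :
    e.dist (γ s) (γ t) ≤ edist s t := by
  wlog hst : s ≤ t generalizing s t
  · rw [e.dist_comm, edist_comm]
    exact this ht hs (le_of_not_ge hst)
  rw [edist_comm, edist_dist, Real.dist_eq, abs_of_nonneg (sub_nonneg.mpr hst)]
  exact e.dist_le_of_isMIntegralCurveOn j isOpen_Ioo hγ hst (Icc_subset_Ioo hs.1 ht.2)

theorem IsComplete.isCompleteField_sharp [T2Space M] {e : Coframe M} (he : e.IsComplete)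
    (j : Fin 3) : IsCompleteField (𝓡 3) (e.sharp j) := by
  refine exists_isMIntegralCurve_of_mapClusterPt ((e.contMDiff_sharp j).of_le (by norm_cast))
    fun γ a b hγ t₀ ht₀ ↦ ?_
  obtain ⟨t, ht, htlim⟩ := mem_closure_iff_seq_limit.mp ht₀
  obtain ⟨q, hq⟩ := he (γ ∘ t) fun ε hε ↦
    let ⟨N, hN⟩ := EMetric.cauchySeq_iff.mp htlim.cauchySeq ε hε
    ⟨N, fun m hm n hn ↦
      (e.dist_le_edist_of_isMIntegralCurveOn j hγ (ht m) (ht n)).trans_lt (hN m hm n hn)⟩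
  have hlim : Tendsto (γ ∘ t) atTop (𝓝 q) := tendsto_def.mpr fun U hU ↦ by
    obtain ⟨c, hc, hcU⟩ := e.exists_dist_lt_imp_mem hU
    filter_upwards [hq.eventually (gt_mem_nhds hc)] with n hn
    exact hcU _ (by rwa [e.dist_comm])
  exact ⟨q, hlim.mapClusterPt.of_comp
    (tendsto_nhdsWithin_iff.mpr ⟨htlim, Eventually.of_forall ht⟩)⟩

end Coframe

end CompletenessOfFlows

/-! ### Normal coframes on `ℝ³` -/

section NormalCoframes

theorem ex_apply_zero : ex 0 = 1 := by simp [ex]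

section LieX

variable {η : OneForm R3}

theorem OneForm.Smooth.fderiv_coeff_apply (hη : η.Smooth) (q v w : R3) :
    fderiv ℝ (fun q' ↦ η.coeff q' v) q w = fderiv ℝ η.coeff q w v := by
  have hdiff : DifferentiableAt ℝ η.coeff q := hη.contDiff_coeff.differentiable (by simp) q
  simp [(hdiff.hasFDerivAt.clm_apply (hasFDerivAt_const v q)).fderiv]

theorem OneForm.Smooth.lieX_eq_fderiv (hη : η.Smooth) (q v : R3) :
    lieX η q v = fderiv ℝ η.coeff q ex v :=
  hη.fderiv_coeff_apply q v ex

theorem OneForm.Smooth.fderiv_coeff_ex (hη : η.Smooth) (hex : ∀ q, η q ex = 0) (q w : R3) :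
    fderiv ℝ η.coeff q w ex = 0 := by
  rw [← hη.fderiv_coeff_apply, show (fun q' ↦ η.coeff q' ex) = fun _ ↦ 0 from funext hex]
  simp

theorem IsClosedSliceFamily.d_eq (h : IsClosedSliceFamily η) (hη : η.Smooth) (q v w : R3) :
    η.d q v w = v 0 * lieX η q w - w 0 * lieX η q v := by
  have hslice := h.2 q (v - v 0 • ex) (w - w 0 • ex) (by simp [ex_apply_zero])
    (by simp [ex_apply_zero])
  rw [hη.d_eq_curl] at hslice ⊢
  simp only [curl, map_sub, map_smul, sub_apply, smul_apply, smul_eq_mul,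
    hη.fderiv_coeff_ex h.1] at hslice
  rw [curl, hη.lieX_eq_fderiv, hη.lieX_eq_fderiv]
  linear_combination hslice

end LieX

section Frame

variable (ε : Coframe R3)

/-- The dual frame of a coframe on `ℝ³`, with values in the fixed space `ℝ³`. -/
def Coframe.frame (i : Fin 3) (q : R3) : R3 := ε.sharp i q

theorem Coframe.coeff_frame (i j : Fin 3) (q : R3) :
    (ε.form i).coeff q (ε.frame j q) = if i = j then 1 else 0 :=
  ε.form_sharp i j q

theorem Coframe.sum_coeff_smul_frame (q v : R3) :
    ∑ i, (ε.form i).coeff q v • ε.frame i q = v := by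
  refine ε.form_injective (p := q) fun j ↦ ?_
  change (ε.form j).coeff q (∑ i, (ε.form i).coeff q v • ε.frame i q) = (ε.form j).coeff q v
  simp [ε.coeff_frame]

theorem Coframe.lieX_eq_sum_frame {η : OneForm R3} (hη : η.Smooth) (q v : R3) :
    lieX η q v = ∑ j, (ε.form j).coeff q v * lieX η q (ε.frame j q) := by
  simp only [hη.lieX_eq_fderiv]
  conv_lhs => rw [← ε.sum_coeff_smul_frame q v]
  simp only [map_sum, map_smul, smul_eq_mul]

theorem lieXMetric_eq (q v w : R3) :
    lieXMetric ε q v w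
      = lieX (ε.form 1) q v * (ε.form 1).coeff q w + (ε.form 1).coeff q v * lieX (ε.form 1) q w
        + (lieX (ε.form 2) q v * (ε.form 2).coeff q w
          + (ε.form 2).coeff q v * lieX (ε.form 2) q w) := by
  have hdiff (i : Fin 3) (v : R3) : DifferentiableAt ℝ (fun q' ↦ (ε.form i).coeff q' v) q :=
    ((ε.smooth i).contDiff_coeff.differentiable (by simp) q).clm_apply (differentiableAt_const v)
  have hleibniz := DFunLike.congr_fun
    (((hdiff 1 v).hasFDerivAt.mul (hdiff 1 w).hasFDerivAt).add
      ((hdiff 2 v).hasFDerivAt.mul (hdiff 2 w).hasFDerivAt)).fderiv ex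
  simp only [add_apply, smul_apply, smul_eq_mul, (ε.smooth _).fderiv_coeff_apply,
    ← (ε.smooth _).lieX_eq_fderiv] at hleibniz
  exact hleibniz.trans (by ring)

theorem isLinearMap_normalTheta (u : R3 → ℝ) (F : ℝ → ℝ) (q w : R3) :
    IsLinearMap ℝ fun v ↦ normalTheta ε u F q v w := by
  have hform (v : R3) : ε.form 0 q v = (ε.form 0).coeff q v := rfl
  constructor <;> intros <;>
    simp only [normalTheta, lieXMetric_eq, (ε.smooth _).lieX_eq_fderiv, hform, map_add, map_smul,
      smul_eq_mul] <;>
    ring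

end Frame

/-- The coframe `ε` has the form `(exp(u) dx, e_l, e_n)`, where `e_l` and `e_n` have no
`dx`-component, but need not restrict to closed forms on the planes `x = const`. -/
structure IsAdapted (ε : Coframe R3) (u : R3 → ℝ) : Prop where
  form_zero : ∀ q v : R3, (ε.form 0).coeff q v = Real.exp (u q) * v 0
  form_ex : ∀ i : Fin 3, i ≠ 0 → ∀ q, (ε.form i).coeff q ex = 0

namespace IsAdapted

variable {ε : Coframe R3} {u : R3 → ℝ}

theorem frame_zero (h : IsAdapted ε u) (q : R3) : ε.frame 0 q = Real.exp (-u q) • ex := by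
  refine (ε.eq_sharp (p := q) (v := (Real.exp (-u q) • ex : R3)) fun i ↦ ?_).symm
  change (ε.form i).coeff q (Real.exp (-u q) • ex) = _
  by_cases hi : i = 0
  · simp [hi, h.form_zero, ex_apply_zero, Real.exp_neg]
  · simp [hi, h.form_ex i hi]

theorem frame_apply_zero (h : IsAdapted ε u) {i : Fin 3} (hi : i ≠ 0) (q : R3) :
    ε.frame i q 0 = 0 := by
  simpa [h.form_zero, hi.symm] using ε.coeff_frame 0 i q

theorem lieX_frame_zero (h : IsAdapted ε u) {i : Fin 3} (hi : i ≠ 0) (q : R3) :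
    lieX (ε.form i) q (ε.frame 0 q) = 0 := by
  rw [(ε.smooth i).lieX_eq_fderiv, h.frame_zero, map_smul,
    (ε.smooth i).fderiv_coeff_ex (h.form_ex i hi), smul_zero]

theorem d_form_zero (h : IsAdapted ε u) (hu : Differentiable ℝ u) (q v w : R3) :
    (ε.form 0).d q v w = fderiv ℝ u q v * (ε.form 0).coeff q w
      - fderiv ℝ u q w * (ε.form 0).coeff q v := by
  have hderiv (v w : R3) :
      fderiv ℝ (ε.form 0).coeff q v w = fderiv ℝ u q v * (ε.form 0).coeff q w := by
    rw [← (ε.smooth 0).fderiv_coeff_apply, funext fun q' ↦ h.form_zero q' w,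
      ((hu q).hasFDerivAt.exp.mul_const (w 0)).fderiv, h.form_zero]
    simp only [smul_apply, smul_eq_mul]
    ring
  rw [(ε.smooth 0).d_eq_curl, curl, hderiv, hderiv]

theorem normalTheta_eq (h : IsAdapted ε u) (hu : Differentiable ℝ u) (F : ℝ → ℝ) (q v w : R3) :
    normalTheta ε u F q v w
      = Real.exp (u q) * ((F (q 0) - fderiv ℝ u q ex) * (v 0 * w 0)
        + v 0 * fderiv ℝ u q w + fderiv ℝ u q v * w 0)
        - 1 / 2 * Real.exp (-u q) * lieXMetric ε q v w := by
  have hderiv : fderiv ℝ (fun q' ↦ Real.exp (-u q')) q ex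
      = -(Real.exp (-u q) * fderiv ℝ u q ex) := by
    rw [(hu q).hasFDerivAt.fun_neg.exp.fderiv]
    simp
  have hexp : Real.exp (-u q) * Real.exp (u q) = 1 := by simp [← Real.exp_add]
  have hform (v : R3) : ε.form 0 q v = Real.exp (u q) * v 0 := h.form_zero q v
  rw [normalTheta, hderiv, hform, hform]
  linear_combination (Real.exp (u q) * (F (q 0) - fderiv ℝ u q ex) * (v 0 * w 0)) * hexp

theorem normalTheta_frame_zero (h : IsAdapted ε u) (hu : Differentiable ℝ u) (F : ℝ → ℝ)
    (q w : R3) :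
    normalTheta ε u F q (ε.frame 0 q) w = F (q 0) * w 0 + fderiv ℝ u q w := by
  have hexp : Real.exp (u q) * Real.exp (-u q) = 1 := by simp [← Real.exp_add]
  rw [h.normalTheta_eq hu, lieXMetric_eq, h.lieX_frame_zero one_ne_zero,
    h.lieX_frame_zero (i := 2) (by decide), ε.coeff_frame, ε.coeff_frame,
    if_neg one_ne_zero, if_neg (by decide), h.frame_zero]
  simp only [map_smul, PiLp.smul_apply, ex_apply_zero, smul_eq_mul]
  linear_combination (F (q 0) * w 0 + fderiv ℝ u q w) * hexp

end IsAdapted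

namespace IsNormalCoframe

variable {ε : Coframe R3} {u : R3 → ℝ}

theorem isClosedSliceFamily (h : IsNormalCoframe ε u) {i : Fin 3} (hi : i ≠ 0) :
    IsClosedSliceFamily (ε.form i) := by
  fin_cases i
  exacts [absurd rfl hi, h.2.1, h.2.2.1]

theorem isAdapted (h : IsNormalCoframe ε u) : IsAdapted ε u where
  form_zero := h.1
  form_ex _ hi := (h.isClosedSliceFamily hi).1

theorem lieXMetric_frame (h : IsNormalCoframe ε u) {i : Fin 3} (hi : i ≠ 0) (q w : R3) :
    lieXMetric ε q (ε.frame i q) w = 2 * lieX (ε.form i) q w := by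
  have hcomm : lieX (ε.form 1) q (ε.frame 2 q) = lieX (ε.form 2) q (ε.frame 1 q) := h.2.2.2 q
  rw [lieXMetric_eq, ε.coeff_frame, ε.coeff_frame, ε.lieX_eq_sum_frame (ε.smooth i) q w,
    ε.lieX_eq_sum_frame (ε.smooth 1) q w, ε.lieX_eq_sum_frame (ε.smooth 2) q w]
  simp only [Fin.sum_univ_three, h.isAdapted.lieX_frame_zero one_ne_zero,
    h.isAdapted.lieX_frame_zero (i := 2) (by decide), h.isAdapted.lieX_frame_zero hi]
  fin_cases i
  · exact absurd rfl hi
  all_goals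
    simp only [Fin.mk_one, Fin.reduceFinMk, hcomm, Fin.isValue, if_true, if_false, Fin.reduceEq]
    ring

theorem normalTheta_frame (h : IsNormalCoframe ε u) (hu : Differentiable ℝ u) (F : ℝ → ℝ)
    {i : Fin 3} (hi : i ≠ 0) (q w : R3) :
    normalTheta ε u F q (ε.frame i q) w
      = Real.exp (u q) * fderiv ℝ u q (ε.frame i q) * w 0
        - Real.exp (-u q) * lieX (ε.form i) q w := by
  rw [h.isAdapted.normalTheta_eq hu, h.lieXMetric_frame hi, h.isAdapted.frame_apply_zero hi]
  ring

theorem d_form (h : IsNormalCoframe ε u) (hu : Differentiable ℝ u) (F : ℝ → ℝ) (i : Fin 3)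
    (q v w : R3) :
    (ε.form i).d q v w = normalTheta ε u F q (ε.frame i q) v * (ε.form 0).coeff q w
      - normalTheta ε u F q (ε.frame i q) w * (ε.form 0).coeff q v := by
  by_cases hi : i = 0
  · subst hi
    rw [h.isAdapted.d_form_zero hu, h.isAdapted.normalTheta_frame_zero hu,
      h.isAdapted.normalTheta_frame_zero hu, h.isAdapted.form_zero, h.isAdapted.form_zero]
    ring
  · have hexp : Real.exp (u q) * Real.exp (-u q) = 1 := by simp [← Real.exp_add]
    rw [(h.isClosedSliceFamily hi).d_eq (ε.smooth i), h.normalTheta_frame hu F hi,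
      h.normalTheta_frame hu F hi, h.isAdapted.form_zero, h.isAdapted.form_zero]
    linear_combination (w 0 * lieX (ε.form i) q v - v 0 * lieX (ε.form i) q w) * hexp

end IsNormalCoframe

namespace IsAdapted

variable {ε : Coframe R3} {u : R3 → ℝ} {T : R3 → R3 →L[ℝ] R3 →L[ℝ] ℝ}

theorem isClosedSliceFamily (h : IsAdapted ε u) {i : Fin 3} (hi : i ≠ 0)
    (hd : ∀ q v w : R3, (ε.form i).d q v w = T q (ε.frame i q) v * (ε.form 0).coeff q w
      - T q (ε.frame i q) w * (ε.form 0).coeff q v) :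
    IsClosedSliceFamily (ε.form i) := by
  refine ⟨h.form_ex i hi, fun q v w hv hw ↦ ?_⟩
  rw [hd, h.form_zero, h.form_zero, hv, hw]
  ring

theorem lieX_eq (h : IsAdapted ε u) {i : Fin 3} (hi : i ≠ 0)
    (hd : ∀ q v w : R3, (ε.form i).d q v w = T q (ε.frame i q) v * (ε.form 0).coeff q w
      - T q (ε.frame i q) w * (ε.form 0).coeff q v) (q w : R3) :
    lieX (ε.form i) q w
      = Real.exp (u q) * (T q (ε.frame i q) ex * w 0 - T q (ε.frame i q) w) := by
  have hdx := (h.isClosedSliceFamily hi hd).d_eq (ε.smooth i) q ex w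
  rw [hd, h.form_zero, h.form_zero, (ε.smooth i).lieX_eq_fderiv q ex,
    (ε.smooth i).fderiv_coeff_ex (h.form_ex i hi), ex_apply_zero] at hdx
  linear_combination -hdx

theorem isNormalCoframe (h : IsAdapted ε u) (hT : ∀ q v w, T q v w = T q w v)
    (hd : ∀ (i : Fin 3) (q v w : R3), (ε.form i).d q v w
      = T q (ε.frame i q) v * (ε.form 0).coeff q w
        - T q (ε.frame i q) w * (ε.form 0).coeff q v) :
    IsNormalCoframe ε u := by
  refine ⟨h.form_zero, h.isClosedSliceFamily one_ne_zero (hd 1),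
    h.isClosedSliceFamily (by decide) (hd 2), fun q ↦ ?_⟩
  change lieX (ε.form 1) q (ε.frame 2 q) = lieX (ε.form 2) q (ε.frame 1 q)
  rw [h.lieX_eq one_ne_zero (hd 1), h.lieX_eq (by decide) (hd 2),
    h.frame_apply_zero one_ne_zero, h.frame_apply_zero (by decide),
    hT q (ε.frame 2 q) (ε.frame 1 q)]
  ring

theorem eq_normalTheta (h : IsAdapted ε u) (hu : Differentiable ℝ u)
    (hT : ∀ q v w, T q v w = T q w v) (h0 : ∀ q w, T q (ε.frame 0 q) w = fderiv ℝ u q w)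
    (hd : ∀ (i : Fin 3) (q v w : R3), (ε.form i).d q v w
      = T q (ε.frame i q) v * (ε.form 0).coeff q w
        - T q (ε.frame i q) w * (ε.form 0).coeff q v) (q v w : R3) :
    T q v w = normalTheta ε u 0 q v w := by
  have hexp : Real.exp (-u q) * Real.exp (u q) = 1 := by simp [← Real.exp_add]
  have hframe (i : Fin 3) : T q (ε.frame i q) w = normalTheta ε u 0 q (ε.frame i q) w := by
    by_cases hi : i = 0
    · simp [hi, h.normalTheta_frame_zero hu, h0]
    · have hex : T q (ε.frame i q) ex = Real.exp (u q) * fderiv ℝ u q (ε.frame i q) := by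
        rw [← h0, h.frame_zero, hT, map_smul, smul_apply, smul_eq_mul]
        linear_combination (-T q ex (ε.frame i q)) * hexp
      rw [(h.isNormalCoframe hT hd).normalTheta_frame hu 0 hi, h.lieX_eq hi (hd i), hex]
      linear_combination
        (Real.exp (u q) * fderiv ℝ u q (ε.frame i q) * w 0 - T q (ε.frame i q) w) * hexp
  let Θ := (isLinearMap_normalTheta ε u 0 q w).mk'
  change T q v w = Θ v
  rw [← ε.sum_coeff_smul_frame q v]
  simp only [map_sum, map_smul, sum_apply, smul_apply]
  exact Finset.sum_congr rfl fun i _ ↦ congrArg _ (hframe i)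

end IsAdapted

end NormalCoframes

section NormalForm

theorem contDiff_primitive {E : Type*} [NormedAddCommGroup E] [NormedSpace ℝ E] [CompleteSpace E]
    {F : ℝ → E} (hF : ContDiff ℝ ∞ F) (a : ℝ) : ContDiff ℝ ∞ fun x ↦ ∫ s in a..x, F s := by
  have hderiv (x : ℝ) : HasDerivAt (fun x ↦ ∫ s in a..x, F s) (F x) x :=
    (hF.continuous.integral_hasStrictDerivAt a x).hasDerivAt
  rw [contDiff_infty_iff_deriv, funext fun x ↦ (hderiv x).deriv]
  exact ⟨fun x ↦ (hderiv x).differentiableAt, hF⟩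

theorem hasMFDerivAt_curve_iff_hasDerivAt {E : Type*} [NormedAddCommGroup E] [NormedSpace ℝ E]
    {c : ℝ → E} {c' : E} {t : ℝ} :
    HasMFDerivAt 𝓘(ℝ, ℝ) 𝓘(ℝ, E) c t ((1 : ℝ →L[ℝ] ℝ).smulRight c') ↔ HasDerivAt c c' t :=
  ⟨fun h ↦ hasDerivAt_iff_hasFDerivAt.mpr h.hasFDerivAt,
    fun h ↦ (hasDerivAt_iff_hasFDerivAt.mp h).hasMFDerivAt⟩

variable {M : Type*} [TopologicalSpace M] [ChartedSpace R3 M]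

theorem mfderiv_apply_mfderiv_symm (φ : M ≃ₘ^∞⟮𝓡 3, 𝓡 3⟯ R3) (q v : R3) :
    (mfderiv (𝓡 3) (𝓡 3) φ (φ.symm q) (mfderiv (𝓡 3) (𝓡 3) φ.symm q v) : R3) = v := by
  have hchain := mfderiv_comp q (φ.contMDiff.mdifferentiableAt (x := φ.symm q) (by simp))
    (φ.symm.contMDiff.mdifferentiableAt (x := q) (by simp))
  rw [show (φ ∘ φ.symm : R3 → R3) = id from funext φ.apply_symm_apply, mfderiv_id] at hchain
  exact (DFunLike.congr_fun hchain v).symm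

/-- The potential `-(u + ∫₀ˣ F)` of a pair in normal form, in the global coordinates. -/
def normalPotential (u : R3 → ℝ) (F : ℝ → ℝ) (q : R3) : ℝ := -(u q + ∫ s in (0 : ℝ)..(q 0), F s)

section Potential

variable {u : R3 → ℝ} {F : ℝ → ℝ}

theorem contDiff_normalPotential (hu : ContDiff ℝ ∞ u) (hF : ContDiff ℝ ∞ F) :
    ContDiff ℝ ∞ (normalPotential u F) := by
  have hcoord : ContDiff ℝ ∞ fun q : R3 ↦ q 0 :=
    (EuclideanSpace.proj (𝕜 := ℝ) (0 : Fin 3)).contDiff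
  exact (hu.add ((contDiff_primitive hF 0).comp hcoord)).neg

theorem fderiv_normalPotential (hu : Differentiable ℝ u) (hF : Continuous F) (q w : R3) :
    fderiv ℝ (normalPotential u F) q w = -(F (q 0) * w 0 + fderiv ℝ u q w) := by
  have hcoord : HasFDerivAt (fun q : R3 ↦ q 0) (EuclideanSpace.proj (𝕜 := ℝ) (0 : Fin 3)) q :=
    (EuclideanSpace.proj (𝕜 := ℝ) (0 : Fin 3)).hasFDerivAt
  have hprim : HasFDerivAt (fun q : R3 ↦ ∫ s in (0 : ℝ)..(q 0), F s)
      (F (q 0) • EuclideanSpace.proj (𝕜 := ℝ) (0 : Fin 3)) q :=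
    HasDerivAt.comp_hasFDerivAt (f := fun q : R3 ↦ q 0) q
      (hF.integral_hasStrictDerivAt 0 (q 0)).hasDerivAt hcoord
  have hpot : HasFDerivAt (normalPotential u F) _ q := ((hu q).hasFDerivAt.add hprim).neg
  simp [hpot.fderiv, add_comm]

end Potential

namespace HasNormalForm

variable [IsManifold (𝓡 3) ∞ M] {e : Coframe M} {Θ : ShapeOperator M}
  {φ : M ≃ₘ^∞⟮𝓡 3, 𝓡 3⟯ R3} {ε : Coframe R3} {u : R3 → ℝ} {F : ℝ → ℝ}

theorem differentiable_u (h : HasNormalForm e Θ φ ε u F) : Differentiable ℝ u :=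
  h.contDiff_u.differentiable (by simp)

theorem mfderiv_sharp (h : HasNormalForm e Θ φ ε u F) (i : Fin 3) (p : M) :
    (mfderiv (𝓡 3) (𝓡 3) φ p (e.sharp i p) : R3) = ε.frame i (φ p) :=
  ε.eq_sharp fun j ↦ by rw [← h.coframe, e.form_sharp]

theorem form_mfderiv_symm (h : HasNormalForm e Θ φ ε u F) (i : Fin 3) (q v : R3) :
    e.form i (φ.symm q) (mfderiv (𝓡 3) (𝓡 3) φ.symm q v) = (ε.form i).coeff q v := by
  rw [h.coframe]
  change (ε.form i).coeff (φ (φ.symm q))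
    (mfderiv (𝓡 3) (𝓡 3) φ (φ.symm q) (mfderiv (𝓡 3) (𝓡 3) φ.symm q v) : R3) = _
  rw [mfderiv_apply_mfderiv_symm, φ.apply_symm_apply]

theorem thetaForm_eq (h : HasNormalForm e Θ φ ε u F) (i : Fin 3) (p : M)
    (v : TangentSpace (𝓡 3) p) :
    thetaForm e Θ i p v
      = normalTheta ε u F (φ p) (ε.frame i (φ p)) (mfderiv (𝓡 3) (𝓡 3) φ p v) := by
  rw [← h.mfderiv_sharp]
  exact h.theta p (e.sharp i p) v

theorem d_form (h : HasNormalForm e Θ φ ε u F) (i : Fin 3) (p : M) (v w : TangentSpace (𝓡 3) p) :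
    (e.form i).d p v w = (ε.form i).d (φ p) (mfderiv (𝓡 3) (𝓡 3) φ p v)
      (mfderiv (𝓡 3) (𝓡 3) φ p w) := by
  obtain ⟨q, rfl⟩ := φ.symm.surjective p
  obtain ⟨(v : R3), rfl⟩ := (φ.symm.mfderivToContinuousLinearEquiv (by simp) q).surjective v
  obtain ⟨(w : R3), rfl⟩ := (φ.symm.mfderivToContinuousLinearEquiv (by simp) q).surjective w
  have hpullback : (e.form i).pullback φ.symm = ε.form i :=
    funext fun q ↦ ContinuousLinearMap.ext fun v ↦ h.form_mfderiv_symm i q v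
  have hd := (e.smooth i).d_pullback φ.symm.contMDiff q v w
  rw [hpullback] at hd
  refine hd.symm.trans ?_
  change (ε.form i).d q v w = (ε.form i).d (φ (φ.symm q))
    (mfderiv (𝓡 3) (𝓡 3) φ (φ.symm q) (mfderiv (𝓡 3) (𝓡 3) φ.symm q v) : R3)
    (mfderiv (𝓡 3) (𝓡 3) φ (φ.symm q) (mfderiv (𝓡 3) (𝓡 3) φ.symm q w) : R3)
  rw [mfderiv_apply_mfderiv_symm, mfderiv_apply_mfderiv_symm, φ.apply_symm_apply]

theorem isPotential (h : HasNormalForm e Θ φ ε u F) :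
    IsPotential e Θ fun p ↦ normalPotential u F (φ p) := by
  have hpot := contDiff_normalPotential h.contDiff_u h.contDiff_F
  refine ⟨hpot.contMDiff.comp φ.contMDiff, fun p v ↦ ?_⟩
  have hchain : (mfderiv (𝓡 3) 𝓘(ℝ, ℝ) (fun p ↦ normalPotential u F (φ p)) p v : ℝ)
      = fderiv ℝ (normalPotential u F) (φ p) (mfderiv (𝓡 3) (𝓡 3) φ p v : R3) := by
    rw [← mfderiv_eq_fderiv]
    exact DFunLike.congr_fun (mfderiv_comp p (hpot.contMDiff.mdifferentiableAt (by simp))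
      (φ.contMDiff.mdifferentiableAt (by simp))) v
  have hfderiv := fderiv_normalPotential h.differentiable_u h.contDiff_F.continuous (φ p)
    (mfderiv (𝓡 3) (𝓡 3) φ p v : R3)
  refine (h.thetaForm_eq 0 p v).trans ?_
  refine (h.normal.isAdapted.normalTheta_frame_zero h.differentiable_u F (φ p) _).trans ?_
  exact (neg_eq_iff_eq_neg.mpr (hchain.trans hfderiv)).symm

theorem isParallel (h : HasNormalForm e Θ φ ε u F) : IsParallel e Θ := by
  refine ⟨fun i p v w ↦ ?_, _, h.isPotential⟩
  rw [h.d_form, h.thetaForm_eq, h.thetaForm_eq, h.coframe, h.coframe]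
  exact h.normal.d_form h.differentiable_u F i (φ p) _ _

theorem mfderiv_symm_smul_ex (h : HasNormalForm e Θ φ ε u F) (q : R3) :
    mfderiv (𝓡 3) (𝓡 3) φ.symm q (Real.exp (∫ s in (0 : ℝ)..(q 0), F s) • ex)
      = (e.rescale _ h.isPotential.1).sharp 0 (φ.symm q) := by
  refine Coframe.eq_sharp _ fun i ↦ ?_
  change (if i = 0 then Real.exp (normalPotential u F (φ (φ.symm q))) else 1)
    * e.form i (φ.symm q) (mfderiv (𝓡 3) (𝓡 3) φ.symm q _) = _
  have hform := h.form_mfderiv_symm i q (Real.exp (∫ s in (0 : ℝ)..(q 0), F s) • ex)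
  rw [hform, map_smul, φ.apply_symm_apply]
  by_cases hi : i = 0
  · rw [if_pos hi, if_pos hi, hi, h.normal.isAdapted.form_zero, ex_apply_zero, normalPotential,
      smul_eq_mul, mul_one, ← Real.exp_add, ← Real.exp_add, Real.exp_eq_one_iff]
    ring
  · simp [hi, h.normal.isAdapted.form_ex i hi]

theorem isCompleteField (h : HasNormalForm e Θ φ ε u F)
    (hF : IsCompleteField 𝓘(ℝ, ℝ) (lineField F)) :
    IsCompleteField (𝓡 3) ((e.rescale _ h.isPotential.1).sharp 0) := by
  intro p
  obtain ⟨c, hc0, hc⟩ := hF (φ p 0)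
  let κ : ℝ → R3 := fun t ↦ φ p + (c t - φ p 0) • ex
  have hκ0 (t : ℝ) : κ t 0 = c t := by simp [κ, ex_apply_zero]
  have hκ (t : ℝ) : HasDerivAt κ (Real.exp (∫ s in (0 : ℝ)..(κ t 0), F s) • ex) t := by
    rw [hκ0]
    have hct := hasMFDerivAt_curve_iff_hasDerivAt.mp (hc t)
    exact ((hct.sub_const _).smul_const ex).const_add (φ p)
  refine ⟨fun t ↦ φ.symm (κ t), by simp [κ, hc0], fun t ↦ ?_⟩
  refine (hasMFDerivAt_comp_curve (φ.symm.contMDiff.mdifferentiableAt (by simp)).hasMFDerivAt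
    (hasMFDerivAt_curve_iff_hasDerivAt.mpr (hκ t))).congr_mfderiv ?_
  exact congrArg _ (h.mfderiv_symm_smul_ex (κ t))

end HasNormalForm

end NormalForm

/-! ### Global coordinates -/

section LeftInverses

open Filter Set

variable {E E' H H' M N : Type*} [NormedAddCommGroup E] [NormedSpace ℝ E]
  [NormedAddCommGroup E'] [NormedSpace ℝ E'] [TopologicalSpace H] [TopologicalSpace H']
  {I : ModelWithCorners ℝ E H} [I.Boundaryless] {J : ModelWithCorners ℝ E' H'} [J.Boundaryless]
  [TopologicalSpace M] [ChartedSpace H M] [TopologicalSpace N] [ChartedSpace H' N]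
  {n : WithTop ℕ∞}

theorem map_nhds_eq_of_surjective_mfderiv [CompleteSpace E] [CompleteSpace E'] {f : M → N} {p : M}
    (hf : ContMDiffAt I J n f p) (hn : n ≠ 0)
    (hsurj : Function.Surjective (mfderiv I J f p)) : map f (𝓝 p) = 𝓝 (f p) := by
  let D : E →L[ℝ] E' := mfderiv I J f p
  have hsmooth : ContDiffAt ℝ n (writtenInExtChartAt I J p f) (extChartAt I p p) := by
    rw [← contDiffWithinAt_univ, ← I.range_eq_univ]
    exact (contMDiffAt_iff.mp hf).2
  have hderiv : HasFDerivAt (writtenInExtChartAt I J p f) D (extChartAt I p p) := by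
    rw [← hasFDerivWithinAt_univ, ← I.range_eq_univ]
    exact (hf.mdifferentiableAt hn).hasMFDerivAt.2
  have hmap := (hsmooth.hasStrictFDerivAt' hderiv hn).map_nhds_eq_of_surj
    (LinearMap.range_eq_top.mpr hsurj)
  have hsource : extChartAt J (f p) ∘ f =ᶠ[𝓝 p] writtenInExtChartAt I J p f ∘ extChartAt I p := by
    filter_upwards [extChartAt_source_mem_nhds (I := I) p] with q hq
    simp only [writtenInExtChartAt, Function.comp_apply, (extChartAt I p).left_inv hq]
  have htarget : (extChartAt J (f p)).symm ∘ extChartAt J (f p) ∘ f =ᶠ[𝓝 p] f := by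
    filter_upwards [hf.continuousAt (extChartAt_source_mem_nhds (I := J) (f p))] with q hq
    exact (extChartAt J (f p)).left_inv hq
  have hchart : writtenInExtChartAt I J p f (extChartAt I p p) = extChartAt J (f p) (f p) :=
    hsource.eq_of_nhds.symm
  rw [← map_congr htarget, ← map_map, map_congr hsource, ← map_map,
    map_extChartAt_nhds_of_boundaryless, hmap, hchart, ← nhdsWithin_univ, ← J.range_eq_univ,
    map_extChartAt_symm_nhdsWithin_range]

variable [FiniteDimensional ℝ E] {J : ModelWithCorners ℝ E H'} [J.Boundaryless]

theorem isOpen_range_of_leftInverse {Φ : N → M} {Ψ : M → N} (hΦ : ContMDiff J I n Φ)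
    (hΨ : ContMDiff I J n Ψ) (hn : n ≠ 0) (h : Function.LeftInverse Φ Ψ) : IsOpen (range Ψ) := by
  rw [isOpen_iff_mem_nhds]
  rintro _ ⟨q, rfl⟩
  let D : E →L[ℝ] E := mfderiv I J Ψ q
  have hchain := mfderiv_comp q (hΦ.mdifferentiableAt hn (x := Ψ q))
    (hΨ.mdifferentiableAt hn (x := q))
  rw [h.comp_eq_id, mfderiv_id] at hchain
  have hinj : Function.Injective D := Function.LeftInverse.injective
    (g := (mfderiv J I Φ (Ψ q) : E → E)) fun v ↦ (DFunLike.congr_fun hchain v).symm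
  have : CompleteSpace E := FiniteDimensional.complete ℝ E
  rw [← map_nhds_eq_of_surjective_mfderiv (hΨ q) hn
    (LinearMap.surjective_of_injective (f := D.toLinearMap) hinj)]
  exact range_mem_map

theorem exists_diffeomorph_of_leftInverse [T2Space N] [ConnectedSpace N] [Nonempty M] {Φ : N → M}
    {Ψ : M → N} (hΦ : ContMDiff J I n Φ) (hΨ : ContMDiff I J n Ψ) (hn : n ≠ 0)
    (h : Function.LeftInverse Φ Ψ) : ∃ φ : Diffeomorph J I N M n, ⇑φ = Φ ∧ ⇑φ.symm = Ψ := by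
  have hrange : range Ψ = {p | Ψ (Φ p) = p} :=
    Subset.antisymm (by rintro _ ⟨q, rfl⟩; exact congrArg Ψ (h q)) fun p hp ↦ ⟨Φ p, hp⟩
  have hclosed : IsClosed (range Ψ) := by
    rw [hrange]
    exact isClosed_eq (hΨ.continuous.comp hΦ.continuous) continuous_id
  have huniv : range Ψ = univ :=
    IsClopen.eq_univ ⟨hclosed, isOpen_range_of_leftInverse hΦ hΨ hn h⟩ (range_nonempty Ψ)
  have hinv (p : N) : Ψ (Φ p) = p := hrange.subset (huniv ▸ mem_univ p)
  exact ⟨⟨⟨Φ, Ψ, hinv, h⟩, hΦ, hΨ⟩, rfl, rfl⟩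

end LeftInverses

section FrameFlows

variable {M : Type*}

section Curves

variable [TopologicalSpace M] [ChartedSpace R3 M] {x : M → ℝ}

theorem eq_add_mul_of_differential_eq {V : (p : M) → TangentSpace (𝓡 3) p}
    (hx : ContMDiff (𝓡 3) 𝓘(ℝ, ℝ) ∞ x) {γ : ℝ → M} (hγ : IsMIntegralCurve γ V) {c : ℝ}
    (h : ∀ t, differential x (γ t) (V (γ t)) = c) (t : ℝ) : x (γ t) = x (γ 0) + c * t := by
  have hderiv (t : ℝ) : HasDerivAt (fun s ↦ x (γ s) - c * s) 0 t := by
    have hxγ := hasMFDerivAt_comp_curve (hx.mdifferentiableAt (by simp)).hasMFDerivAt (hγ t)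
    have hxγ' : HasDerivAt (fun s ↦ x (γ s)) c t := h t ▸ hasMFDerivAt_curve_iff_hasDerivAt.mp hxγ
    have hline : HasDerivAt (fun s ↦ c * s) c t := by simpa using (hasDerivAt_id t).const_mul c
    exact sub_self c ▸ hxγ'.fun_sub hline
  have hconst := is_const_of_deriv_eq_zero (fun t ↦ (hderiv t).differentiableAt)
    (fun t ↦ (hderiv t).deriv) t 0
  linarith

theorem mfderiv_apply_of_comp_eq {N : Type*} [TopologicalSpace N] [ChartedSpace R3 N] {r : N → M}
    {c : ℝ → N} {c' : ℝ → M} {t : ℝ} {v : TangentSpace (𝓡 3) (c t)}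
    {w : TangentSpace (𝓡 3) (c' t)} (hr : MDifferentiableAt (𝓡 3) (𝓡 3) r (c t))
    (hc : HasMFDerivAt 𝓘(ℝ, ℝ) (𝓡 3) c t ((1 : ℝ →L[ℝ] ℝ).smulRight v))
    (hc' : HasMFDerivAt 𝓘(ℝ, ℝ) (𝓡 3) c' t ((1 : ℝ →L[ℝ] ℝ).smulRight w))
    (h : ∀ s, r (c s) = c' s) : (mfderiv (𝓡 3) (𝓡 3) r (c t) v : R3) = w := by
  obtain rfl : (fun s ↦ r (c s)) = c' := funext h
  have heval (z : R3) : (1 : ℝ →L[ℝ] ℝ).smulRight z 1 = z := one_smul ℝ z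
  have hunique := hasMFDerivAt_unique (hasMFDerivAt_comp_curve hr.hasMFDerivAt hc) hc'
  exact (heval _).symm.trans ((DFunLike.congr_fun hunique (1 : ℝ)).trans (heval _))

theorem differential_mfderiv_of_comp_eq_const {N : Type*} [TopologicalSpace N] [ChartedSpace R3 N]
    {r : N → M} {p : N} (hx : MDifferentiableAt (𝓡 3) 𝓘(ℝ, ℝ) x (r p))
    (hr : MDifferentiableAt (𝓡 3) (𝓡 3) r p) {c : ℝ} (h : ∀ q, x (r q) = c)
    (v : TangentSpace (𝓡 3) p) : differential x (r p) (mfderiv (𝓡 3) (𝓡 3) r p v) = 0 := by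
  have hchain := mfderiv_comp p hx hr
  rw [show x ∘ r = fun _ ↦ c from funext h, mfderiv_const] at hchain
  exact (DFunLike.congr_fun hchain v).symm

theorem mfderiv_apply_coord {Φ : M → R3} {p : M} (hΦ : MDifferentiableAt (𝓡 3) (𝓡 3) Φ p)
    (i : Fin 3) (v : TangentSpace (𝓡 3) p) :
    (mfderiv (𝓡 3) (𝓡 3) Φ p v : R3).ofLp i = differential (fun p ↦ Φ p i) p v := by
  have hproj : HasMFDerivAt (𝓡 3) 𝓘(ℝ, ℝ) (fun q : R3 ↦ q i) (Φ p)
      (EuclideanSpace.proj (𝕜 := ℝ) i) :=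
    (EuclideanSpace.proj (𝕜 := ℝ) i).hasFDerivAt.hasMFDerivAt
  exact (DFunLike.congr_fun (hproj.comp p hΦ.hasMFDerivAt).mfderiv v).symm

end Curves

section SliceProjection

/-- The projection onto the slice `x = 0` along a flow on which `x` grows at unit speed. -/
def sliceProjection (φ : M → ℝ → M) (x : M → ℝ) (p : M) : M := φ p (-x p)

variable {φ : M → ℝ → M} {x : M → ℝ}

theorem apply_sliceProjection (hxφ : ∀ p t, x (φ p t) = x p + t) (p : M) :
    x (sliceProjection φ x p) = 0 := by
  simp [sliceProjection, hxφ]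

theorem sliceProjection_eq_self (h0 : ∀ p, φ p 0 = p) {p : M} (hp : x p = 0) :
    sliceProjection φ x p = p := by
  simp [sliceProjection, hp, h0]

theorem sliceProjection_flow (hadd : ∀ p s t, φ (φ p s) t = φ p (t + s))
    (hxφ : ∀ p t, x (φ p t) = x p + t) (p : M) (t : ℝ) :
    sliceProjection φ x (φ p t) = sliceProjection φ x p := by
  simp [sliceProjection, hadd, hxφ]

theorem contMDiff_sliceProjection [TopologicalSpace M] [ChartedSpace R3 M]
    (hφ : ContMDiff ((𝓡 3).prod 𝓘(ℝ, ℝ)) (𝓡 3) ∞ fun z : M × ℝ ↦ φ z.1 z.2)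
    (hx : ContMDiff (𝓡 3) 𝓘(ℝ, ℝ) ∞ x) :
    ContMDiff (𝓡 3) (𝓡 3) ∞ (sliceProjection φ x) :=
  hφ.comp (contMDiff_id.prodMk hx.neg)

end SliceProjection

section FlowParametrization

/-- The point reached from `p₀` by following three flows for the times given by `q`, the flow with
index `0` last. -/
def flowParametrization (ψ : Fin 3 → M → ℝ → M) (p₀ : M) (q : R3) : M :=
  ψ 0 (ψ 1 (ψ 2 p₀ (q 2)) (q 1)) (q 0)

variable {ψ : Fin 3 → M → ℝ → M} {c : Fin 3 → M → ℝ}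

theorem coord_flowParametrization
    (h : ∀ i j p t, (j ≠ 0 → c 0 p = 0) → c i (ψ j p t) = c i p + if i = j then t else 0)
    {p₀ : M} (hp₀ : c 0 p₀ = 0) (q : R3) (i : Fin 3) :
    c i (flowParametrization ψ p₀ q) = c i p₀ + q i := by
  have hslice₂ : c 0 (ψ 2 p₀ (q 2)) = 0 := by simp [h 0 2 p₀ _ fun _ ↦ hp₀, hp₀]
  rw [flowParametrization, h i 0 _ _ fun hne ↦ absurd rfl hne, h i 1 _ _ fun _ ↦ hslice₂,
    h i 2 _ _ fun _ ↦ hp₀]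
  fin_cases i <;> simp

variable [TopologicalSpace M] [ChartedSpace R3 M]

theorem contMDiff_flowParametrization
    (hψ : ∀ j, ContMDiff ((𝓡 3).prod 𝓘(ℝ, ℝ)) (𝓡 3) ∞ fun z : M × ℝ ↦ ψ j z.1 z.2) (p₀ : M) :
    ContMDiff (𝓡 3) (𝓡 3) ∞ (flowParametrization ψ p₀) := by
  have hcoord (i : Fin 3) : ContMDiff (𝓡 3) 𝓘(ℝ, ℝ) ∞ fun q : R3 ↦ q i :=
    (EuclideanSpace.proj (𝕜 := ℝ) i).contDiff.contMDiff
  have hψ₂ := (hψ 2).comp ((contMDiff_const (c := p₀)).prodMk (hcoord 2))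
  exact (hψ 0).comp (((hψ 1).comp (hψ₂.prodMk (hcoord 1))).prodMk (hcoord 0))

theorem exists_diffeomorph_symm_eq_flowParametrization [T2Space M] [ConnectedSpace M]
    (hc : ∀ i, ContMDiff (𝓡 3) 𝓘(ℝ, ℝ) ∞ (c i))
    (hψ : ∀ j, ContMDiff ((𝓡 3).prod 𝓘(ℝ, ℝ)) (𝓡 3) ∞ fun z : M × ℝ ↦ ψ j z.1 z.2)
    (h : ∀ i j p t, (j ≠ 0 → c 0 p = 0) → c i (ψ j p t) = c i p + if i = j then t else 0)
    {p₀ : M} (hp₀ : c 0 p₀ = 0) :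
    ∃ φ : M ≃ₘ^∞⟮𝓡 3, 𝓡 3⟯ R3,
      (∀ p, φ p 0 = c 0 p) ∧ ⇑φ.symm = flowParametrization ψ p₀ := by
  let Φ : M → R3 := fun p ↦ WithLp.toLp 2 fun i ↦ c i p - c i p₀
  have hΦ : ContMDiff (𝓡 3) (𝓡 3) ∞ Φ :=
    (EuclideanSpace.equiv (Fin 3) ℝ).symm.contDiff.contMDiff.comp
      (contMDiff_pi_space.mpr fun i ↦ (hc i).sub contMDiff_const)
  have hinv : Function.LeftInverse Φ (flowParametrization ψ p₀) := fun q ↦ by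
    ext i
    simp [Φ, coord_flowParametrization h hp₀]
  obtain ⟨φ, hφ, hφsymm⟩ := exists_diffeomorph_of_leftInverse hΦ
    (contMDiff_flowParametrization hψ p₀) (by simp) hinv
  exact ⟨φ, fun p ↦ by simp [hφ, Φ, hp₀], hφsymm⟩

end FlowParametrization

variable [TopologicalSpace M] [ChartedSpace R3 M] [IsManifold (𝓡 3) ∞ M]

/-- `ψ j` is the flow of the `j`-th vector field of the frame dual to a coframe. -/
structure IsFrameFlow (e : Coframe M) (ψ : Fin 3 → M → ℝ → M) : Prop where
  apply_zero : ∀ j p, ψ j p 0 = p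
  isMIntegralCurve : ∀ j p, IsMIntegralCurve (ψ j p) (e.sharp j)

namespace IsFrameFlow

variable {e : Coframe M} {ψ : Fin 3 → M → ℝ → M} {x g : M → ℝ}

theorem add [T2Space M] (h : IsFrameFlow e ψ) (j : Fin 3) (p : M) (s t : ℝ) :
    ψ j (ψ j p s) t = ψ j p (t + s) :=
  have := IsManifold.of_le (I := 𝓡 3) (M := M) (n := ∞) (m := 1) (by norm_cast)
  integralFlow_add ((e.contMDiff_sharp j).of_le (by norm_cast)) (h.apply_zero j)
    (h.isMIntegralCurve j) p s t

theorem contMDiff [T2Space M] (h : IsFrameFlow e ψ) (j : Fin 3) :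
    ContMDiff ((𝓡 3).prod 𝓘(ℝ, ℝ)) (𝓡 3) ∞ fun z : M × ℝ ↦ ψ j z.1 z.2 :=
  contMDiff_integralFlow (e.contMDiff_sharp j) (h.apply_zero j) (h.isMIntegralCurve j)

theorem apply_of_differential_sharp_eq (h : IsFrameFlow e ψ) (hg : ContMDiff (𝓡 3) 𝓘(ℝ, ℝ) ∞ g)
    {i j : Fin 3} {p : M}
    (hdiff : ∀ t, differential g (ψ j p t) (e.sharp j (ψ j p t)) = if i = j then 1 else 0)
    (t : ℝ) : g (ψ j p t) = g p + if i = j then t else 0 := by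
  have hcurve := eq_add_mul_of_differential_eq hg (h.isMIntegralCurve j p) hdiff t
  simpa [h.apply_zero] using hcurve

theorem apply_of_form_eq_differential (h : IsFrameFlow e ψ) (hx : ContMDiff (𝓡 3) 𝓘(ℝ, ℝ) ∞ x)
    {i : Fin 3} (hform : e.form i = differential x) (j : Fin 3) (p : M) (t : ℝ) :
    x (ψ j p t) = x p + if i = j then t else 0 :=
  h.apply_of_differential_sharp_eq hx (fun t ↦ by rw [← hform, e.form_sharp]) t

variable [T2Space M]

theorem mfderiv_sliceProjection_sharp_zero (h : IsFrameFlow e ψ)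
    (hx : ContMDiff (𝓡 3) 𝓘(ℝ, ℝ) ∞ x) (hform : e.form 0 = differential x) (p : M) (t : ℝ) :
    mfderiv (𝓡 3) (𝓡 3) (sliceProjection (ψ 0) x) (ψ 0 p t) (e.sharp 0 (ψ 0 p t)) = 0 := by
  have hr := contMDiff_sliceProjection (h.contMDiff 0) hx
  have hconst : HasMFDerivAt 𝓘(ℝ, ℝ) (𝓡 3) (fun _ : ℝ ↦ sliceProjection (ψ 0) x p) t
      ((1 : ℝ →L[ℝ] ℝ).smulRight (0 : R3)) :=
    (hasMFDerivAt_const _ t).congr_mfderiv (ContinuousLinearMap.ext fun s : ℝ ↦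
      (smul_zero (A := R3) s).symm)
  exact mfderiv_apply_of_comp_eq (hr.mdifferentiableAt (by simp)) (h.isMIntegralCurve 0 p t) hconst
    (sliceProjection_flow (h.add 0) (fun p t ↦ h.apply_of_form_eq_differential hx hform 0 p t) p)

theorem mfderiv_sliceProjection_sharp (h : IsFrameFlow e ψ)
    (hx : ContMDiff (𝓡 3) 𝓘(ℝ, ℝ) ∞ x) (hform : e.form 0 = differential x) {j : Fin 3} (hj : j ≠ 0)
    {p : M} (hp : x p = 0) (t : ℝ) :
    (mfderiv (𝓡 3) (𝓡 3) (sliceProjection (ψ 0) x) (ψ j p t) (e.sharp j (ψ j p t)) : R3)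
      = e.sharp j (ψ j p t) := by
  have hr := contMDiff_sliceProjection (h.contMDiff 0) hx
  refine mfderiv_apply_of_comp_eq (hr.mdifferentiableAt (by simp)) (h.isMIntegralCurve j p t)
    (h.isMIntegralCurve j p t) fun s ↦ sliceProjection_eq_self (h.apply_zero 0) ?_
  rw [h.apply_of_form_eq_differential hx hform, hp, if_neg hj.symm, add_zero]

theorem apply_of_pullback_form_eq_differential (h : IsFrameFlow e ψ)
    (hx : ContMDiff (𝓡 3) 𝓘(ℝ, ℝ) ∞ x) (hform : e.form 0 = differential x)
    (hg : ContMDiff (𝓡 3) 𝓘(ℝ, ℝ) ∞ g) {i : Fin 3} (hi : i ≠ 0)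
    (hpullback : (e.form i).pullback (sliceProjection (ψ 0) x) = differential g) {j : Fin 3} {p : M}
    (hp : j ≠ 0 → x p = 0) (t : ℝ) :
    g (ψ j p t) = g p + if i = j then t else 0 := by
  refine h.apply_of_differential_sharp_eq hg (fun t ↦ ?_) t
  rw [← hpullback]
  change e.form i (sliceProjection (ψ 0) x (ψ j p t)) (mfderiv (𝓡 3) (𝓡 3) _ _ _) = _
  by_cases hj : j = 0
  · subst hj
    rw [h.mfderiv_sliceProjection_sharp_zero hx hform, map_zero, if_neg hi]
  · have hself : sliceProjection (ψ 0) x (ψ j p t) = ψ j p t :=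
      sliceProjection_eq_self (h.apply_zero 0) (by
        rw [h.apply_of_form_eq_differential hx hform, hp hj, if_neg (Ne.symm hj), add_zero])
    rw [← e.form_sharp i j (ψ j p t)]
    exact (congrArg (e.form i _) (h.mfderiv_sliceProjection_sharp hx hform hj (hp hj) t)).trans
      (congrArg (fun z ↦ (e.form i z : R3 →L[ℝ] ℝ) (e.sharp j (ψ j p t))) hself)

theorem form_zero_mfderiv_sliceProjection (h : IsFrameFlow e ψ)
    (hx : ContMDiff (𝓡 3) 𝓘(ℝ, ℝ) ∞ x) (hform : e.form 0 = differential x) (p : M)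
    (v : TangentSpace (𝓡 3) p) :
    e.form 0 (sliceProjection (ψ 0) x p)
      (mfderiv (𝓡 3) (𝓡 3) (sliceProjection (ψ 0) x) p v) = 0 := by
  have hr := contMDiff_sliceProjection (h.contMDiff 0) hx
  rw [hform]
  exact differential_mfderiv_of_comp_eq_const (hx.mdifferentiableAt (by simp))
    (hr.mdifferentiableAt (by simp))
    (apply_sliceProjection fun p t ↦ h.apply_of_form_eq_differential hx hform 0 p t) v

end IsFrameFlow

end FrameFlows

section AdaptedCoordinates

variable {M : Type*} [TopologicalSpace M] [ChartedSpace R3 M] [IsManifold (𝓡 3) ∞ M]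
  {e : Coframe M}

theorem mfderiv_flowParametrization_ex [T2Space M] {ψ : Fin 3 → M → ℝ → M}
    (h : IsFrameFlow e ψ) (p₀ : M) (q : R3) :
    (mfderiv (𝓡 3) (𝓡 3) (flowParametrization ψ p₀) q ex : R3)
      = e.sharp 0 (flowParametrization ψ p₀ q) := by
  let κ : ℝ → R3 := fun t ↦ q + (t - q 0) • ex
  have hκ : HasDerivAt κ ex (q 0) := by
    have hshift := (((hasDerivAt_id (q 0)).sub_const (q 0)).smul_const ex).const_add q
    rwa [one_smul] at hshift
  have hκq : κ (q 0) = q := by simp [κ]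
  have hline (s : ℝ) : flowParametrization ψ p₀ (κ s) = ψ 0 (ψ 1 (ψ 2 p₀ (q 2)) (q 1)) s := by
    simp [flowParametrization, κ, ex]
  have hsmooth := contMDiff_flowParametrization h.contMDiff p₀
  have hmf : (mfderiv (𝓡 3) (𝓡 3) (flowParametrization ψ p₀) (κ (q 0)) ex : R3)
      = e.sharp 0 (flowParametrization ψ p₀ q) :=
    mfderiv_apply_of_comp_eq (hsmooth.mdifferentiableAt (by simp))
      (hasMFDerivAt_curve_iff_hasDerivAt.mpr hκ) (h.isMIntegralCurve 0 _ (q 0)) hline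
  rwa [hκq] at hmf

theorem exists_diffeomorph_of_isCompleteField_sharp [T2Space M] [SimplyConnectedSpace M]
    (he : ∀ j, IsCompleteField (𝓡 3) (e.sharp j))
    (hclosed : ∀ p (v w : TangentSpace (𝓡 3) p), (e.form 0).d p v w = 0)
    (hleaf : ∀ i p (v w : TangentSpace (𝓡 3) p), e.form 0 p v = 0 → e.form 0 p w = 0 →
      (e.form i).d p v w = 0) :
    ∃ φ : M ≃ₘ^∞⟮𝓡 3, 𝓡 3⟯ R3,
      (∀ p (v : TangentSpace (𝓡 3) p), (mfderiv (𝓡 3) (𝓡 3) φ p v : R3).ofLp 0 = e.form 0 p v) ∧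
        ∀ q, (mfderiv (𝓡 3) (𝓡 3) φ.symm q ex : R3) = e.sharp 0 (φ.symm q) := by
  obtain ⟨x, hx, hform⟩ := ((e.smooth 0).locallyExact_pullback contMDiff_id
    fun p v w ↦ hclosed _ _ _).exists_eq_differential
  rw [OneForm.pullback_id] at hform
  choose ψ hψ0 hψ using he
  have hflow : IsFrameFlow e ψ := ⟨hψ0, hψ⟩
  have hr := contMDiff_sliceProjection (hflow.contMDiff 0) hx
  choose g hg hgform using fun i ↦ ((e.smooth i).locallyExact_pullback hr fun p v w ↦
    hleaf i _ _ _ (hflow.form_zero_mfderiv_sliceProjection hx hform p v)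
      (hflow.form_zero_mfderiv_sliceProjection hx hform p w)).exists_eq_differential
  let c : Fin 3 → M → ℝ := fun i ↦ if i = 0 then x else g i
  have hc (i : Fin 3) : ContMDiff (𝓡 3) 𝓘(ℝ, ℝ) ∞ (c i) := by
    by_cases hi : i = 0
    · simpa [c, hi] using hx
    · simpa [c, hi] using hg i
  have hcflow (i j : Fin 3) (p : M) (t : ℝ) (hp : j ≠ 0 → x p = 0) :
      c i (ψ j p t) = c i p + if i = j then t else 0 := by
    by_cases hi : i = 0
    · subst hi
      exact hflow.apply_of_form_eq_differential hx hform j p t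
    · simpa [c, hi] using
        hflow.apply_of_pullback_form_eq_differential hx hform (hg i) hi (hgform i) hp t
  obtain ⟨p₁⟩ : Nonempty M := inferInstance
  obtain ⟨φ, hφ, hφsymm⟩ := exists_diffeomorph_symm_eq_flowParametrization hc hflow.contMDiff hcflow
    (apply_sliceProjection (fun p t ↦ hflow.apply_of_form_eq_differential hx hform 0 p t) p₁)
  refine ⟨φ, fun p v ↦ ?_, fun q ↦ ?_⟩
  · rw [mfderiv_apply_coord (φ.contMDiff.mdifferentiableAt (by simp)), hform]
    exact congrArg (fun y : M → ℝ ↦ differential y p v) (funext hφ)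
  · rw [hφsymm]
    exact mfderiv_flowParametrization_ex hflow _ q

end AdaptedCoordinates

section ExistenceOfNormalForm

variable {M : Type*} [TopologicalSpace M] [ChartedSpace R3 M]

theorem differential_exp_comp {f : M → ℝ} (hf : MDifferentiable (𝓡 3) 𝓘(ℝ, ℝ) f) (p : M)
    (v : TangentSpace (𝓡 3) p) :
    differential (fun p ↦ Real.exp (f p)) p v = Real.exp (f p) * differential f p v := by
  have hexp := (Real.hasDerivAt_exp (f p)).hasFDerivAt.hasMFDerivAt
  rw [mul_comm]
  exact DFunLike.congr_fun (hexp.comp p (hf p).hasMFDerivAt).mfderiv v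

variable [IsManifold (𝓡 3) ∞ M] {e : Coframe M} {Θ : ShapeOperator M} {f : M → ℝ}

namespace Coframe

section Rescale

variable (hf : ContMDiff (𝓡 3) 𝓘(ℝ, ℝ) ∞ f)

theorem rescale_form_zero :
    (e.rescale f hf).form 0 = fun p ↦ Real.exp (f p) • e.form 0 p := rfl

theorem rescale_form {i : Fin 3} (hi : i ≠ 0) : (e.rescale f hf).form i = e.form i := by
  funext p
  simp [rescale, hi]

theorem rescale_sharp {j : Fin 3} (hj : j ≠ 0) : (e.rescale f hf).sharp j = e.sharp j := by
  refine funext fun p ↦ (Coframe.eq_sharp _ fun i ↦ ?_).symm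
  by_cases hi : i = 0
  · subst hi
    rw [rescale_form_zero, smul_apply, e.form_sharp, if_neg hj.symm, smul_zero]
  · rw [rescale_form hf hi, e.form_sharp]

end Rescale

/-- The coframe on `ℝ³` which represents a coframe on `M` in global coordinates `φ`. -/
def inCoordinates (e : Coframe M) (φ : M ≃ₘ^∞⟮𝓡 3, 𝓡 3⟯ R3) : Coframe R3 where
  form i := (e.form i).pullback φ.symm
  smooth i := (e.smooth i).smooth_pullback φ.symm.contMDiff
  bijective q := (e.bijective (φ.symm q)).comp
    (φ.symm.mfderivToContinuousLinearEquiv (by simp) q).bijective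

theorem mfderiv_symm_frame_inCoordinates (e : Coframe M) (φ : M ≃ₘ^∞⟮𝓡 3, 𝓡 3⟯ R3) (j : Fin 3)
    (q : R3) :
    mfderiv (𝓡 3) (𝓡 3) φ.symm q ((e.inCoordinates φ).frame j q) = e.sharp j (φ.symm q) :=
  e.eq_sharp fun i ↦ (e.inCoordinates φ).coeff_frame i j q

theorem form_eq_inCoordinates (e : Coframe M) (φ : M ≃ₘ^∞⟮𝓡 3, 𝓡 3⟯ R3) (i : Fin 3) (p : M)
    (v : TangentSpace (𝓡 3) p) :
    e.form i p v = (e.inCoordinates φ).form i (φ p) (mfderiv (𝓡 3) (𝓡 3) φ p v) := by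
  obtain ⟨q, rfl⟩ := φ.symm.surjective p
  obtain ⟨(v : R3), rfl⟩ := (φ.symm.mfderivToContinuousLinearEquiv (by simp) q).surjective v
  change _ = ((e.inCoordinates φ).form i).coeff (φ (φ.symm q))
    (mfderiv (𝓡 3) (𝓡 3) φ (φ.symm q) (mfderiv (𝓡 3) (𝓡 3) φ.symm q v) : R3)
  rw [mfderiv_apply_mfderiv_symm, φ.apply_symm_apply]
  rfl

end Coframe

/-- The two-tensor on `ℝ³` which represents a shape operator on `M` in global coordinates `φ`,
with values in the bilinear forms on the fixed space `ℝ³`. -/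
def ShapeOperator.inCoordinates (Θ : ShapeOperator M) (φ : M ≃ₘ^∞⟮𝓡 3, 𝓡 3⟯ R3) (q : R3) :
    R3 →L[ℝ] R3 →L[ℝ] ℝ :=
  (show R3 →L[ℝ] R3 →L[ℝ] ℝ from Θ.tensor (φ.symm q)).bilinearComp
    (show R3 →L[ℝ] R3 from mfderiv (𝓡 3) (𝓡 3) φ.symm q)
    (show R3 →L[ℝ] R3 from mfderiv (𝓡 3) (𝓡 3) φ.symm q)

theorem ShapeOperator.inCoordinates_comm (Θ : ShapeOperator M) (φ : M ≃ₘ^∞⟮𝓡 3, 𝓡 3⟯ R3)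
    (q v w : R3) : Θ.inCoordinates φ q v w = Θ.inCoordinates φ q w v :=
  Θ.symm _ _ _

theorem ShapeOperator.tensor_eq_inCoordinates (Θ : ShapeOperator M) (φ : M ≃ₘ^∞⟮𝓡 3, 𝓡 3⟯ R3)
    (p : M) (v w : TangentSpace (𝓡 3) p) :
    Θ.tensor p v w = Θ.inCoordinates φ (φ p) (mfderiv (𝓡 3) (𝓡 3) φ p v)
      (mfderiv (𝓡 3) (𝓡 3) φ p w) := by
  obtain ⟨q, rfl⟩ := φ.symm.surjective p
  obtain ⟨(v : R3), rfl⟩ := (φ.symm.mfderivToContinuousLinearEquiv (by simp) q).surjective v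
  obtain ⟨(w : R3), rfl⟩ := (φ.symm.mfderivToContinuousLinearEquiv (by simp) q).surjective w
  change _ = Θ.inCoordinates φ (φ (φ.symm q))
    (mfderiv (𝓡 3) (𝓡 3) φ (φ.symm q) (mfderiv (𝓡 3) (𝓡 3) φ.symm q v) : R3)
    (mfderiv (𝓡 3) (𝓡 3) φ (φ.symm q) (mfderiv (𝓡 3) (𝓡 3) φ.symm q w) : R3)
  rw [mfderiv_apply_mfderiv_symm, mfderiv_apply_mfderiv_symm, φ.apply_symm_apply]
  rfl

theorem inCoordinates_frame_apply (φ : M ≃ₘ^∞⟮𝓡 3, 𝓡 3⟯ R3) (i : Fin 3) (q w : R3) :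
    Θ.inCoordinates φ q ((e.inCoordinates φ).frame i q) w
      = thetaForm e Θ i (φ.symm q) (mfderiv (𝓡 3) (𝓡 3) φ.symm q w) := by
  rw [thetaForm, ← e.mfderiv_symm_frame_inCoordinates φ]
  rfl

theorem inCoordinates_frame_zero_apply (hf : IsPotential e Θ f) (φ : M ≃ₘ^∞⟮𝓡 3, 𝓡 3⟯ R3)
    (q w : R3) :
    Θ.inCoordinates φ q ((e.inCoordinates φ).frame 0 q) w
      = fderiv ℝ (fun q ↦ -f (φ.symm q)) q w := by
  have hchain : HasFDerivAt (fun q ↦ f (φ.symm q)) _ q :=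
    ((hf.1.mdifferentiableAt (by simp)).hasMFDerivAt.comp q
      (φ.symm.contMDiff.mdifferentiableAt (by simp)).hasMFDerivAt).hasFDerivAt
  rw [inCoordinates_frame_apply, hf.2, hchain.fun_neg.fderiv]
  rfl

theorem IsPotential.d_rescale_form_zero (hf : IsPotential e Θ f)
    (hd : ∀ p (v w : TangentSpace (𝓡 3) p), (e.form 0).d p v w
      = thetaForm e Θ 0 p v * e.form 0 p w - thetaForm e Θ 0 p w * e.form 0 p v)
    (p : M) (v w : TangentSpace (𝓡 3) p) : ((e.rescale f hf.1).form 0).d p v w = 0 := by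
  have hexp (v : TangentSpace (𝓡 3) p) :
      differential (fun p ↦ Real.exp (f p)) p v = -(Real.exp (f p) * thetaForm e Θ 0 p v) := by
    have hdf : thetaForm e Θ 0 p v = -differential f p v := hf.2 p v
    rw [differential_exp_comp (hf.1.mdifferentiable (by simp)), hdf, mul_neg, neg_neg]
  have hg : ContMDiff (𝓡 3) 𝓘(ℝ, ℝ) ∞ fun p ↦ Real.exp (f p) :=
    Real.contDiff_exp.comp_contMDiff hf.1
  rw [Coframe.rescale_form_zero, (e.smooth 0).d_smul hg, hexp, hexp, hd]
  ring

theorem IsPotential.isAdapted_inCoordinates (hf : IsPotential e Θ f)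
    {φ : M ≃ₘ^∞⟮𝓡 3, 𝓡 3⟯ R3}
    (hx : ∀ p (v : TangentSpace (𝓡 3) p),
      (mfderiv (𝓡 3) (𝓡 3) φ p v : R3).ofLp 0 = (e.rescale f hf.1).form 0 p v)
    (hex : ∀ q, (mfderiv (𝓡 3) (𝓡 3) φ.symm q ex : R3) = (e.rescale f hf.1).sharp 0 (φ.symm q)) :
    IsAdapted (e.inCoordinates φ) (fun q ↦ -f (φ.symm q)) where
  form_zero q v := by
    have hxq := hx (φ.symm q) (mfderiv (𝓡 3) (𝓡 3) φ.symm q v)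
    rw [mfderiv_apply_mfderiv_symm, Coframe.rescale_form_zero] at hxq
    rw [hxq, smul_apply, smul_eq_mul, ← mul_assoc, ← Real.exp_add, neg_add_cancel, Real.exp_zero,
      one_mul]
    rfl
  form_ex i hi q := by
    have hsharp := (e.rescale f hf.1).form_sharp i 0 (φ.symm q)
    rw [Coframe.rescale_form hf.1 hi, if_neg hi, ← hex] at hsharp
    exact hsharp

theorem IsPotential.hasNormalForm_inCoordinates (hf : IsPotential e Θ f)
    (hd : ∀ (i : Fin 3) (p : M) (v w : TangentSpace (𝓡 3) p), (e.form i).d p v w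
      = thetaForm e Θ i p v * e.form 0 p w - thetaForm e Θ i p w * e.form 0 p v)
    {φ : M ≃ₘ^∞⟮𝓡 3, 𝓡 3⟯ R3}
    (hadapted : IsAdapted (e.inCoordinates φ) fun q ↦ -f (φ.symm q)) :
    HasNormalForm e Θ φ (e.inCoordinates φ) (fun q ↦ -f (φ.symm q)) 0 := by
  have hu : ContDiff ℝ ∞ (fun q ↦ -f (φ.symm q)) := (hf.1.comp φ.symm.contMDiff).neg.contDiff
  have hdcoord (i : Fin 3) (q v w : R3) : ((e.inCoordinates φ).form i).d q v w
      = Θ.inCoordinates φ q ((e.inCoordinates φ).frame i q) v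
          * ((e.inCoordinates φ).form 0).coeff q w
        - Θ.inCoordinates φ q ((e.inCoordinates φ).frame i q) w
          * ((e.inCoordinates φ).form 0).coeff q v := by
    rw [inCoordinates_frame_apply, inCoordinates_frame_apply]
    exact ((e.smooth i).d_pullback φ.symm.contMDiff q v w).trans (hd i _ _ _)
  exact
    { contDiff_u := hu
      contDiff_F := contDiff_const
      coframe := e.form_eq_inCoordinates φ
      normal := hadapted.isNormalCoframe (Θ.inCoordinates_comm φ) hdcoord
      theta p v w := (Θ.tensor_eq_inCoordinates φ p v w).trans (hadapted.eq_normalTheta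
        (hu.differentiable (by simp)) (Θ.inCoordinates_comm φ)
        (inCoordinates_frame_zero_apply hf φ) hdcoord _ _ _) }

theorem exists_hasNormalForm [T2Space M] [SimplyConnectedSpace M]
    (hd : ∀ (i : Fin 3) (p : M) (v w : TangentSpace (𝓡 3) p), (e.form i).d p v w
      = thetaForm e Θ i p v * e.form 0 p w - thetaForm e Θ i p w * e.form 0 p v)
    (he : e.IsComplete) (hf : IsPotential e Θ f)
    (hcomplete : IsCompleteField (𝓡 3) ((e.rescale f hf.1).sharp 0)) :
    ∃ (φ : M ≃ₘ^∞⟮𝓡 3, 𝓡 3⟯ R3) (ε : Coframe R3) (u : R3 → ℝ), HasNormalForm e Θ φ ε u 0 := by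
  have hsharp (j : Fin 3) : IsCompleteField (𝓡 3) ((e.rescale f hf.1).sharp j) := by
    by_cases hj : j = 0
    · exact hj ▸ hcomplete
    · rw [Coframe.rescale_sharp hf.1 hj]
      exact he.isCompleteField_sharp j
  have hclosed := hf.d_rescale_form_zero (hd 0)
  have hleaf (i : Fin 3) (p : M) (v w : TangentSpace (𝓡 3) p)
      (hv : (e.rescale f hf.1).form 0 p v = 0) (hw : (e.rescale f hf.1).form 0 p w = 0) :
      ((e.rescale f hf.1).form i).d p v w = 0 := by
    by_cases hi : i = 0
    · exact hi ▸ hclosed p v w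
    · have hker {v : TangentSpace (𝓡 3) p} (hv : (e.rescale f hf.1).form 0 p v = 0) :
          e.form 0 p v = 0 := (mul_eq_zero.mp hv).resolve_left (Real.exp_ne_zero _)
      rw [Coframe.rescale_form hf.1 hi, hd, hker hv, hker hw, mul_zero, mul_zero, sub_zero]
  obtain ⟨φ, hx, hex⟩ := exists_diffeomorph_of_isCompleteField_sharp hsharp hclosed hleaf
  exact ⟨φ, _, _, hf.hasNormalForm_inCoordinates hd (hf.isAdapted_inCoordinates hx hex)⟩

theorem isCompleteField_lineField_zero : IsCompleteField 𝓘(ℝ, ℝ) (lineField 0) := by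
  intro p
  refine ⟨fun t ↦ t + p, zero_add p, fun t ↦ ?_⟩
  have hline : (lineField 0 (t + p) : ℝ) = 1 := by
    change Real.exp _ = 1
    simp
  rw [hline]
  exact hasMFDerivAt_curve_iff_hasDerivAt.mpr ((hasDerivAt_id t).add_const p)

end ExistenceOfNormalForm

end CauchyPair

end

theorem mainTheorem2 {M : Type*} [TopologicalSpace M] [ChartedSpace CauchyPair.R3 M]
    [IsManifold (𝓡 3) ∞ M] [T2Space M] [SecondCountableTopology M]
    [ConnectedSpace M] [SimplyConnectedSpace M]
    (e : CauchyPair.Coframe M) (Θ : CauchyPair.ShapeOperator M) :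
    ((CauchyPair.IsParallel e Θ ∧ CauchyPair.IsFullyComplete e Θ) ↔
      ∃ (φ : M ≃ₘ^∞⟮𝓡 3, 𝓡 3⟯ CauchyPair.R3) (ε : CauchyPair.Coframe CauchyPair.R3)
        (u : CauchyPair.R3 → ℝ) (F : ℝ → ℝ),
        CauchyPair.HasNormalForm e Θ φ ε u F ∧
          e.IsComplete ∧ CauchyPair.IsCompleteField 𝓘(ℝ, ℝ) (CauchyPair.lineField F)) ∧
    ∀ (φ : M ≃ₘ^∞⟮𝓡 3, 𝓡 3⟯ CauchyPair.R3) (ε : CauchyPair.Coframe CauchyPair.R3)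
      (u : CauchyPair.R3 → ℝ) (F : ℝ → ℝ),
      CauchyPair.HasNormalForm e Θ φ ε u F → CauchyPair.IsParallel e Θ := by
  refine ⟨⟨?_, ?_⟩, fun φ ε u F h ↦ h.isParallel⟩
  · rintro ⟨⟨hd, -⟩, he, f, hf, hcomplete⟩
    obtain ⟨φ, ε, u, h⟩ := CauchyPair.exists_hasNormalForm hd he hf hcomplete
    exact ⟨φ, ε, u, 0, h, he, CauchyPair.isCompleteField_lineField_zero⟩
  · rintro ⟨φ, ε, u, F, h, he, hF⟩
    exact ⟨h.isParallel, he, _, h.isPotential, h.isCompleteField hF⟩
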